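/- **Setting.** Let $f:\{0,1\}^n\to\{0,1\}$ with $N:=|f^{-1}(1)|\ge 1$. Write $x^{(i)}$ for $x$ with its $i$-th bit flipped, $\Delta(\cdot,\cdot)$ for Hamming distance and $\log=\log_2$. The function $f$ is *unate* if for every $i\in[n]$ it is either nondecreasing or nonincreasing in the $i$-th coordinate. Put $\mathsf{reldist}(f,g)=|f^{-1}(1)\,\triangle\, g^{-1}(1)|/|f^{-1}(1)|$ and $\mathsf{reldist}(f,\mathsf{Unate})=\min_{g\text{ unate}}\mathsf{reldist}(f,g)$. An algorithm accesses $f$ only through $\mathrm{MQ}(f)$ (query a point, receive the value of $f$ there) and $\mathrm{SAMP}(f)$ (receive a fresh uniform element of $f^{-1}(1)$), and may use internal randomness. It is *non-adaptive* if it makes a number of calls to $\mathrm{SAMP}(f)$ that is fixed by its inputs, then one parallel round of queries to $\mathrm{MQ}(f)$ (which may depend on the samples and on the internal randomness, but not on answers to other queries), and then decides. For $d\in\{0,1,*\}^n$ let $\mathsf{Fixed}(d)=\{i: d_i\ne *\}$, let $\mathsf{Unfixed}(d)=\{i:d_i=*\}$, and for $z\in\{0,1\}^n$ let $z\triangle d=\{i\in\mathsf{Fixed}(d):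 z_i\ne d_i\}$. Samples are independent, and sets of samples are taken with multiplicity. **Algorithm Unateness-Tester-Known-$N$** (inputs $N$, $\varepsilon$). 1. Draw $a\sim\mathrm{SAMP}(f)$. 2. Draw $S$ consisting of $\lceil 400\log N\rceil$ samples. Reject if some $x\in S$ has $\Delta(x,a)>2\log N$. For each $i$ let $d_i=0$ if fewer than a $1/4$ fraction of the $z\in S$ have $z_i=1$, $d_i=1$ if more than a $3/4$ fraction do, and $d_i=*$ otherwise (also $d_i=*$ if $S$ is empty). 3. Draw $T$ consisting of $\lceil 30/\varepsilon\rceil$ samples. Reject if some $x\in T$ has $\Delta(x,a)>2\log N$. Let $M=2\log N+|a\triangle d|$ and $\varepsilon'=\varepsilon/64$. 4. (*BiasedTest*) Skip this step if $\mathsf{Fixed}(d)=\emptyset$. Otherwise repeat $10\lceil M/\varepsilon'\rceil$ times: draw $z\sim\mathrm{SAMP}(f)$; if $z\triangle d\ne\emptyset$, pick $i\in z\triangle d$ uniformly and query $f(z^{(i)})$; if $f(z^{(i)})=0$, then, up to $25$ times, draw $w\sim\mathrm{SAMP}(f)$ and query $f(w^{(i)})$, and reject as soon as $w_i=d_i$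 and $f(w^{(i)})=0$. 5. (*UnbiasedTest*) Let $U=|\mathsf{Unfixed}(d)|$; skip this step if $U=0$. Otherwise, for $r=1,\dots,L$ with $L=\lceil\log(U/\varepsilon')\rceil+2$, repeat $\lceil 50U/(\varepsilon' 2^r)\rceil$ times: pick $i\in\mathsf{Unfixed}(d)$ uniformly, draw $3\cdot 2^r$ samples, query $f(z^{(i)})$ for each such sample $z$, and reject if among them there are $x,y$ with $x_i=0$, $y_i=1$ and $f(x^{(i)})=f(y^{(i)})=0$. 6. Accept. **Theorem.** Unateness-Tester-Known-$N$, run with access to $\mathrm{MQ}(f)$ and $\mathrm{SAMP}(f)$ for an arbitrary $f:\{0,1\}^n\to\{0,1\}$ with $N=|f^{-1}(1)|\ge1$, on inputs $N$ and $\varepsilon\in(0,1]$, has the following properties. * *Complexity.* If $N\ge 2$, then on every execution it makes $\tilde O((\log N)/\varepsilon)$ calls to $\mathrm{SAMP}(f)$ and $\mathrm{MQ}(f)$ in total; that is, at most $C\,X\,(\ln(2+X))^{k}$ with $X=(\log N)/\varepsilon$ and absolute constants $C,k$. * *Completeness (one-sidedness).* If $f$ is unate, it accepts with probability $1$. * *Soundness.*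 If $\mathsf{reldist}(f,\mathsf{Unate})\ge\varepsilon$ (in particular, if $f$ is $\varepsilon$-far from unate in relative distance, i.e. $\mathsf{reldist}(f,\mathsf{Unate})>\varepsilon$), it rejects with probability at least $2/3$. Moreover, there is a non-adaptive algorithm, given $n$, $N$, $\varepsilon$, $\mathrm{MQ}(f)$ and $\mathrm{SAMP}(f)$, with the same completeness and soundness guarantees, which on every execution makes $\tilde O((\log N)/\varepsilon)$ oracle calls in total (in the same sense, with absolute constants, and for all $N\ge1$). -/

import Mathlib

namespace RelUnate

noncomputable section

/-! ## Boolean functions, unateness, relative distance -/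

/-- The hypercube `{0,1}^n`. -/
abbrev Cube (n : ℕ) := Fin n → Bool

/-- Partial strings in `{0,1,*}^n`; `none` is the symbol `*`. -/
abbrev PString (n : ℕ) := Fin n → Option Bool

/-- `x^{(i)}`: the string `x` with its `i`-th bit flipped. -/
def flipBit {n : ℕ} (x : Cube n) (i : Fin n) : Cube n := Function.update x i (!(x i))

/-- `f⁻¹(1)`. -/
def ones {n : ℕ} (f : Cube n → Bool) : Finset (Cube n) :=
  Finset.univ.filter fun x => f x = true

/-- `f` is `b`-monotone in direction `i` (`b = 1`: nondecreasing, `b = 0`: nonincreasing). -/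
def MonotoneInDir {n : ℕ} (f : Cube n → Bool) (i : Fin n) (b : Bool) : Prop :=
  ∀ x : Cube n, f (Function.update x i (!b)) ≤ f (Function.update x i b)

/-- `f` is unate. -/
def Unate {n : ℕ} (f : Cube n → Bool) : Prop :=
  ∀ i : Fin n, MonotoneInDir f i true ∨ MonotoneInDir f i false

/-- `reldist(f, g) = |f⁻¹(1) Δ g⁻¹(1)| / |f⁻¹(1)|` (used only when `f⁻¹(1)` is nonempty). -/
def reldist {n : ℕ} (f g : Cube n → Bool) : ℝ :=
  ((symmDiff (ones f) (ones g)).card : ℝ) / ((ones f).card : ℝ)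

/-- `reldist(f, C)`, the minimum of `reldist(f, g)` over `g ∈ C`
(an infimum over a finite set of values; it is attained when `C` is nonempty). -/
def reldistTo {n : ℕ} (f : Cube n → Bool) (C : Set (Cube n → Bool)) : ℝ :=
  sInf (reldist f '' C)

/-! ## Randomized algorithms with the oracles `MQ(f)` and `SAMP(f)` -/

/-- Randomized oracle algorithms on `{0,1}^n` with output in `α`, as decision trees.  The only
access to the tested function is through `samp` and `query`. -/
inductive OracleProg (n : ℕ) (α : Type) : Type
  /-- halt with an output -/
  | done (a : α) : OracleProg n α
  /-- call `SAMP(f)` and continue with the sample -/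
  | samp (k : Cube n → OracleProg n α) : OracleProg n α
  /-- call `MQ(f)` on `x` and continue with the answer -/
  | query (x : Cube n) (k : Bool → OracleProg n α) : OracleProg n α
  /-- internal randomness: a uniform element of `{0, …, m}` -/
  | toss (m : ℕ) (k : Fin (m + 1) → OracleProg n α) : OracleProg n α

namespace OracleProg

variable {n : ℕ} {α β : Type}

/-- Sequential composition. -/
def andThen : OracleProg n α → (α → OracleProg n β) → OracleProg n β
  | done a, g => g a
  | samp k, g => samp fun z => (k z).andThen g
  | query x k, g => query x fun v => (k v).andThen g
  | toss m k, g => toss m fun j => (k j).andThen g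

instance : Monad (OracleProg n) where
  pure := done
  bind := andThen

/-- The output distribution of the algorithm when it is run on `f`: `SAMP(f)` returns a fresh
uniform element of `f⁻¹(1)` and `MQ(f)` returns the value of `f`. -/
def run (f : Cube n → Bool) (hf : (ones f).Nonempty) : OracleProg n α → PMF α
  | done a => PMF.pure a
  | samp k => (PMF.uniformOfFinset (ones f) hf).bind fun z => run f hf (k z)
  | query x k => run f hf (k (f x))
  | toss m k => (PMF.uniformOfFintype (Fin (m + 1))).bind fun j => run f hf (k j)

/-- The total number of calls to `SAMP(f)` and `MQ(f)` in the worst case over all possible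
executions on `f` (all outcomes of the samples and of the internal randomness). -/
def maxCalls (f : Cube n → Bool) : OracleProg n α → ℕ
  | done _ => 0
  | samp k => 1 + (ones f).sup fun z => maxCalls f (k z)
  | query x k => 1 + maxCalls f (k (f x))
  | toss m k => Finset.univ.sup fun j : Fin (m + 1) => maxCalls f (k j)

/-- One call to `SAMP(f)`. -/
def sample : OracleProg n (Cube n) := samp done

/-- `m` independent samples, listed with multiplicity. -/
def samples : ℕ → OracleProg n (List (Cube n))
  | 0 => pure []
  | m + 1 => do
      let z ← sample
      let S ← samples m
      pure (z :: S)

/-- One call to `MQ(f)`. -/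
def ask (x : Cube n) : OracleProg n Bool := query x done

/-- Query all points of a list fixed in advance, and return the list of answers. -/
def askAll : List (Cube n) → OracleProg n (List Bool)
  | [] => pure []
  | x :: xs => do
      let v ← ask x
      let vs ← askAll xs
      pure (v :: vs)

/-- A uniform element of the nonempty set `s` of coordinates. -/
def uniformFrom (s : Finset (Fin n)) (hs : s.Nonempty) : OracleProg n (Fin n) :=
  toss (s.card - 1) fun j =>
    done (s.orderEmbOfFin (Nat.sub_add_cancel hs.card_pos).symm j)

/-- Run tests (`true` = passed, `false` = reject) one after the other, halting with `false` at the
first one that rejects. -/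
def runAll : List (OracleProg n Bool) → OracleProg n Bool
  | [] => pure true
  | p :: ps => do
      let ok ← p
      if ok then runAll ps else pure false

/-- `NonAdaptive m p`: the algorithm `p` makes exactly `m` calls to the sampling oracle, then one
parallel round of membership queries, and then decides.  The list of queries may depend on the
samples and on the internal randomness, but not on the answers to other queries. -/
inductive NonAdaptive : ℕ → OracleProg n α → Prop
  | round (xs : List (Cube n)) (decision : List Bool → α) :
      NonAdaptive 0 (askAll xs >>= fun vs => pure (decision vs))
  | samp {m : ℕ} (k : Cube n → OracleProg n α) (h : ∀ z, NonAdaptive m (k z)) :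
      NonAdaptive (m + 1) (OracleProg.samp k)
  | toss {m : ℕ} (r : ℕ) (k : Fin (r + 1) → OracleProg n α) (h : ∀ j, NonAdaptive m (k j)) :
      NonAdaptive m (OracleProg.toss r k)

end OracleProg

open OracleProg

/-! ## The algorithm Unateness-Tester-Known-N

In all tests the output `true` means "return / accept" and `false` means "reject". -/

/-- `Fixed(d)`. -/
def fixedCoords {n : ℕ} (d : PString n) : Finset (Fin n) :=
  Finset.univ.filter fun i => d i ≠ none

/-- `Unfixed(d)`. -/
def unfixedCoords {n : ℕ} (d : PString n) : Finset (Fin n) :=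
  Finset.univ.filter fun i => d i = none

/-- `x Δ d`, the set of coordinates fixed by `d` on which `x` differs from `d`. -/
def diffSet {n : ℕ} (x : Cube n) (d : PString n) : Finset (Fin n) :=
  Finset.univ.filter fun i => d i = some (!(x i))

/-- ConfirmDirection with `t` repetitions: draw `z ∼ SAMP(f)`, query `f(z^{(i)})`, and answer
"Yes" (`true`) if `{z, z^{(i)}}` is strictly `b`-monotone, which, since `f z = 1`, means `z i = b`
and `f(z^{(i)}) = 0`. -/
def confirmDirection {n : ℕ} (i : Fin n) (b : Bool) : ℕ → OracleProg n Bool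
  | 0 => pure false
  | t + 1 => do
      let z ← sample
      let v ← ask (flipBit z i)
      if z i = b ∧ v = false then pure true else confirmDirection i b t

/-- One iteration of the loop of BiasedTest.  Here `!(z i)` is the value `d i`, for `i ∈ z Δ d`. -/
def biasedStep {n : ℕ} (d : PString n) : OracleProg n Bool := do
  let z ← sample
  if h : (diffSet z d).Nonempty then do
    let i ← uniformFrom (diffSet z d) h
    let v ← ask (flipBit z i)
    if v = false then do
      let yes ← confirmDirection i (!(z i)) 25
      pure (!yes)
    else pure true
  else pure true

/-- BiasedTest. -/
def biasedTest {n : ℕ} (M ε' : ℝ) (d : PString n) : OracleProg n Bool :=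
  if fixedCoords d = ∅ then pure true
  else runAll (List.replicate (10 * ⌈M / ε'⌉₊) (biasedStep d))

/-- One iteration of the inner loop of UnbiasedTest, at level `r`. -/
def unbiasedStep {n : ℕ} (d : PString n) (h : (unfixedCoords d).Nonempty) (r : ℕ) :
    OracleProg n Bool := do
  let i ← uniformFrom (unfixedCoords d) h
  let S ← samples (3 * 2 ^ r)
  let vs ← askAll (S.map fun z => flipBit z i)
  -- reject iff some samples `x, y` have `x i = 0`, `y i = 1`, and both neighbours have value 0
  if (∃ p ∈ S.zip vs, p.1 i = false ∧ p.2 = false) ∧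
      (∃ q ∈ S.zip vs, q.1 i = true ∧ q.2 = false)
  then pure false else pure true

/-- UnbiasedTest: for `r = 1, …, L`, repeat the inner step `s_r` times. -/
def unbiasedTest {n : ℕ} (ε' : ℝ) (d : PString n) : OracleProg n Bool :=
  if h : (unfixedCoords d).Nonempty then
    let U : ℝ := ((unfixedCoords d).card : ℝ)
    let L : ℕ := ⌈Real.logb 2 (U / ε')⌉₊ + 2
    runAll ((List.range L).map fun j =>
      runAll (List.replicate ⌈50 * U / (ε' * 2 ^ (j + 1))⌉₊ (unbiasedStep d h (j + 1))))
  else pure true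

/-- The estimated bias vector: coordinate `i` is `0` if less than a quarter of the samples `z` in
`S` (with multiplicity) have `z i = 1`, it is `1` if more than three quarters have, and `*`
otherwise. -/
def biasVector {n : ℕ} (S : List (Cube n)) : PString n := fun i =>
  if 4 * S.countP (fun z => z i) < S.length then some false
  else if 3 * S.length < 4 * S.countP (fun z => z i) then some true
  else none

open Classical in
/-- Unateness-Tester-Known-N, with inputs `N` and `ε`. -/
def unatenessTesterKnownN (n N : ℕ) (ε : ℝ) : OracleProg n Bool := do
  -- Phase 0
  let a ← sample
  -- Phase 1
  let S ← samples ⌈400 * Real.logb 2 N⌉₊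
  if ∃ x ∈ S, 2 * Real.logb 2 N < (hammingDist x a : ℝ) then pure false
  else do
    let d : PString n := biasVector S
    -- Phase 2
    let T ← samples ⌈30 / ε⌉₊
    if ∃ x ∈ T, 2 * Real.logb 2 N < (hammingDist x a : ℝ) then pure false
    else do
      let M : ℝ := 2 * Real.logb 2 N + ((diffSet a d).card : ℝ)
      -- Phase 3
      runAll [biasedTest M (ε / 64) d, unbiasedTest (ε / 64) d]

/-! ## Guarantees of a tester that is given `N` and `ε` -/

/-- A tester: for each dimension `n` and inputs `N`, `ε`, an oracle algorithm with output accept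
(`true`) or reject (`false`). -/
abbrev Tester := ∀ n : ℕ, ℕ → ℝ → OracleProg n Bool

/-- The tester, given `N = |f⁻¹(1)|` and `ε`, accepts every unate `f` with probability one. -/
def AlwaysAcceptsUnate (A : Tester) : Prop :=
  ∀ (n : ℕ) (f : Cube n → Bool) (hf : (ones f).Nonempty) (ε : ℝ), 0 < ε → ε ≤ 1 →
    Unate f → run f hf (A n (ones f).card ε) true = 1

/-- The tester, given `N = |f⁻¹(1)|` and `ε`, rejects with probability at least `2/3` every `f`
whose relative distance to the class of unate functions is at least `ε`. -/
def RejectsFarFromUnate (A : Tester) : Prop :=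
  ∀ (n : ℕ) (f : Cube n → Bool) (hf : (ones f).Nonempty) (ε : ℝ), 0 < ε → ε ≤ 1 →
    ε ≤ reldistTo f {g | Unate g} → 2 / 3 ≤ run f hf (A n (ones f).card ε) false

/-- The tester, given `N = |f⁻¹(1)| ≥ N₀` and `ε`, makes `Õ(log N / ε)` oracle calls in total: at
most `C · X · (log (2 + X)) ^ k` on every execution, where `X = log₂ N / ε` and the constants `C`
and `k` are absolute. -/
def MakesSoftOCalls (A : Tester) (N₀ : ℕ) : Prop :=
  ∃ (C : ℝ) (k : ℕ), ∀ (n : ℕ) (f : Cube n → Bool) (ε : ℝ), (ones f).Nonempty →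
    N₀ ≤ (ones f).card → 0 < ε → ε ≤ 1 →
      (maxCalls f (A n (ones f).card ε) : ℝ) ≤
        C * (Real.logb 2 (ones f).card / ε) *
          Real.log (2 + Real.logb 2 (ones f).card / ε) ^ k

end

end RelUnate

namespace RelUnate

open OracleProg Finset

namespace OracleProg

variable {n : ℕ} {α β : Type}

/-- The average of `h` over `f⁻¹(1)`. -/
noncomputable def avg (f : Cube n → Bool) (h : Cube n → ℝ) : ℝ :=
  (∑ z ∈ ones f, h z) / (ones f).card

/-- The expectation of `φ` of the output of a program run on `f`. -/
noncomputable def expect (f : Cube n → Bool) : OracleProg n α → (α → ℝ) → ℝ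
  | done a, φ => φ a
  | samp k, φ => avg f fun z => expect f (k z) φ
  | query x k, φ => expect f (k (f x)) φ
  | toss m k, φ => (∑ j, expect f (k j) φ) / (m + 1)

/-- Every execution of the program on `f` ends with an output satisfying `Q`. -/
def Always (f : Cube n → Bool) : OracleProg n α → (α → Prop) → Prop
  | done a, Q => Q a
  | samp k, Q => ∀ z ∈ ones f, Always f (k z) Q
  | query x k, Q => Always f (k (f x)) Q
  | toss _ k, Q => ∀ j, Always f (k j) Q

variable {f : Cube n → Bool}

theorem mem_ones {z : Cube n} : z ∈ ones f ↔ f z = true := by simp [ones]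

section avg

variable {h h' : Cube n → ℝ}

theorem avg_add : avg f (fun z => h z + h' z) = avg f h + avg f h' := by
  simp only [avg, sum_add_distrib, add_div]

theorem avg_const_mul (c : ℝ) : avg f (fun z => c * h z) = c * avg f h := by
  simp only [avg, ← mul_sum, mul_div_assoc]

theorem avg_mono (H : ∀ z ∈ ones f, h z ≤ h' z) : avg f h ≤ avg f h' :=
  div_le_div_of_nonneg_right (sum_le_sum H) (Nat.cast_nonneg _)

theorem avg_congr (H : ∀ z ∈ ones f, h z = h' z) : avg f h = avg f h' := by
  simp only [avg]; rw [sum_congr rfl H]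

theorem avg_const (hf : (ones f).Nonempty) (c : ℝ) : avg f (fun _ => c) = c := by
  have : ((ones f).card : ℝ) ≠ 0 := by exact_mod_cast hf.card_pos.ne'
  simp only [avg, sum_const, nsmul_eq_mul]
  field_simp

theorem avg_nonneg (H : ∀ z ∈ ones f, 0 ≤ h z) : 0 ≤ avg f h :=
  div_nonneg (sum_nonneg H) (Nat.cast_nonneg _)

theorem avg_le_const (hf : (ones f).Nonempty) {c : ℝ} (H : ∀ z ∈ ones f, h z ≤ c) :
    avg f h ≤ c :=
  (avg_mono H).trans_eq (avg_const hf c)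

theorem avg_indicator (P : Cube n → Prop) [DecidablePred P] :
    avg f (fun z => if P z then 1 else 0) = ((ones f).filter P).card / (ones f).card := by
  simp [avg]

end avg

theorem expect_bind (p : OracleProg n α) (g : α → OracleProg n β) (φ : β → ℝ) :
    expect f (p >>= g) φ = expect f p fun a => expect f (g a) φ := by
  change expect f (p.andThen g) φ = _
  induction p with
  | done a => rfl
  | samp k ih => simp only [andThen, expect, ih]
  | query x k ih => simp only [andThen, expect, ih]
  | toss m k ih => simp only [andThen, expect, ih]

theorem expect_pure (a : α) (φ : α → ℝ) : expect f (pure a : OracleProg n α) φ = φ a := rfl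

theorem expect_ask (x : Cube n) (φ : Bool → ℝ) : expect f (ask x) φ = φ (f x) := rfl

theorem expect_sample (φ : Cube n → ℝ) : expect f sample φ = avg f φ := rfl

theorem expect_askAll (xs : List (Cube n)) (φ : List Bool → ℝ) :
    expect f (askAll xs) φ = φ (xs.map f) := by
  induction xs generalizing φ with
  | nil => rfl
  | cons x xs ih => simp [askAll, expect_bind, expect_ask, expect_pure, ih]

theorem always_bind (p : OracleProg n α) (g : α → OracleProg n β) (Q : β → Prop) :
    Always f (p >>= g) Q ↔ Always f p fun a => Always f (g a) Q := by
  change Always f (p.andThen g) Q ↔ _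
  induction p with
  | done a => rfl
  | samp k ih => simp only [andThen, Always, ih]
  | query x k ih => simp only [andThen, Always, ih]
  | toss m k ih => simp only [andThen, Always, ih]

theorem always_pure (a : α) (Q : α → Prop) : Always f (pure a : OracleProg n α) Q ↔ Q a := Iff.rfl

theorem always_ask (x : Cube n) (Q : Bool → Prop) : Always f (ask x) Q ↔ Q (f x) := Iff.rfl

theorem always_sample (Q : Cube n → Prop) : Always f sample Q ↔ ∀ z ∈ ones f, Q z := Iff.rfl

theorem always_askAll (xs : List (Cube n)) (Q : List Bool → Prop) :
    Always f (askAll xs) Q ↔ Q (xs.map f) := by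
  induction xs generalizing Q with
  | nil => rfl
  | cons x xs ih => simp [askAll, always_bind, always_ask, always_pure, ih]

theorem Always.mono {p : OracleProg n α} {Q Q' : α → Prop} (h : Always f p Q)
    (hQ : ∀ a, Q a → Q' a) : Always f p Q' := by
  induction p with
  | done a => exact hQ _ h
  | samp k ih => exact fun z hz => ih z (h z hz)
  | query x k ih => exact ih _ h
  | toss m k ih => exact fun j => ih j (h j)

theorem always_of_forall (p : OracleProg n α) {Q : α → Prop} (hQ : ∀ a, Q a) : Always f p Q := by
  induction p with
  | done a => exact hQ _
  | samp k ih => exact fun z _ => ih z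
  | query x k ih => exact ih _
  | toss m k ih => exact fun j => ih j

theorem always_samples (m : ℕ) :
    Always f (samples m) fun S => S.length = m ∧ ∀ x ∈ S, f x = true := by
  induction m with
  | zero => exact ⟨rfl, by simp⟩
  | succ m ih =>
    simp only [samples, always_bind, always_sample, always_pure]
    intro z hz
    refine ih.mono ?_
    rintro S ⟨h1, h2⟩
    exact ⟨by simp [h1], by simpa [mem_ones.1 hz] using h2⟩

theorem expect_mono {p : OracleProg n α} {φ ψ : α → ℝ} (h : Always f p fun a => φ a ≤ ψ a) :
    expect f p φ ≤ expect f p ψ := by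
  induction p with
  | done a => exact h
  | samp k ih => exact avg_mono fun z hz => ih z (h z hz)
  | query x k ih => exact ih _ h
  | toss m k ih =>
    exact div_le_div_of_nonneg_right (sum_le_sum fun j _ => ih j (h j)) (by positivity)

theorem expect_congr {p : OracleProg n α} {φ ψ : α → ℝ} (h : Always f p fun a => φ a = ψ a) :
    expect f p φ = expect f p ψ :=
  le_antisymm (expect_mono (h.mono fun _ h => h.le)) (expect_mono (h.mono fun _ h => h.ge))

theorem expect_add (p : OracleProg n α) (φ ψ : α → ℝ) :
    expect f p (fun a => φ a + ψ a) = expect f p φ + expect f p ψ := by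
  induction p with
  | done a => rfl
  | samp k ih => simp only [expect, ih, avg_add]
  | query x k ih => simp only [expect, ih]
  | toss m k ih => simp only [expect, ih, sum_add_distrib, add_div]

theorem expect_const_mul (p : OracleProg n α) (c : ℝ) (φ : α → ℝ) :
    expect f p (fun a => c * φ a) = c * expect f p φ := by
  induction p with
  | done a => rfl
  | samp k ih => simp only [expect, ih, avg_const_mul]
  | query x k ih => simp only [expect, ih]
  | toss m k ih => simp only [expect, ih, ← mul_sum, mul_div_assoc]

theorem expect_mul_const (p : OracleProg n α) (c : ℝ) (φ : α → ℝ) :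
    expect f p (fun a => φ a * c) = expect f p φ * c := by
  simp only [mul_comm _ c, expect_const_mul]

theorem expect_const (hf : (ones f).Nonempty) (p : OracleProg n α) (c : ℝ) :
    expect f p (fun _ => c) = c := by
  induction p with
  | done a => rfl
  | samp k ih => simp only [expect, ih, avg_const hf]
  | query x k ih => simp only [expect, ih]
  | toss m k ih =>
    have : (m + 1 : ℝ) ≠ 0 := by positivity
    simp [expect, ih]; field_simp

theorem expect_sum {ι : Type} (s : Finset ι) (hf : (ones f).Nonempty) (p : OracleProg n α)
    (φ : ι → α → ℝ) :
    expect f p (fun a => ∑ i ∈ s, φ i a) = ∑ i ∈ s, expect f p (φ i) := by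
  classical
  induction s using Finset.induction_on with
  | empty => simpa using expect_const hf p 0
  | insert i s hi ih => simp only [sum_insert hi, expect_add, ih]

theorem expect_le_const (hf : (ones f).Nonempty) {p : OracleProg n α} {φ : α → ℝ} {c : ℝ}
    (h : Always f p fun a => φ a ≤ c) : expect f p φ ≤ c :=
  (expect_mono h).trans_eq (expect_const hf p c)

theorem expect_nonneg (hf : (ones f).Nonempty) {p : OracleProg n α} {φ : α → ℝ}
    (h : ∀ a, 0 ≤ φ a) : 0 ≤ expect f p φ :=
  (expect_const hf p 0).symm.trans_le (expect_mono (always_of_forall p h))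

theorem run_eq_ofReal_expect (hf : (ones f).Nonempty) (p : OracleProg n Bool) (b : Bool) :
    run f hf p b = ENNReal.ofReal (expect f p fun x => if x = b then 1 else 0) := by
  have h0 : ∀ p : OracleProg n Bool, 0 ≤ expect f p fun x => if x = b then 1 else 0 :=
    fun p => expect_nonneg hf fun a => by split_ifs <;> norm_num
  induction p with
  | done a =>
    simp only [run, expect, PMF.pure_apply, eq_comm]
    split_ifs <;> simp
  | samp k ih =>
    have hN : (0 : ℝ) < (ones f).card := by exact_mod_cast hf.card_pos
    simp only [run, expect, avg, PMF.bind_apply, tsum_fintype, PMF.uniformOfFinset_apply, ih]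
    rw [ENNReal.ofReal_div_of_pos hN, ENNReal.ofReal_sum_of_nonneg fun z _ => h0 (k z),
      ENNReal.ofReal_natCast, div_eq_mul_inv, sum_mul]
    simp only [ite_mul, zero_mul, sum_ite_mem, univ_inter]
    simp only [mul_comm]
  | query x k ih => simp only [run, expect, ih]
  | toss m k ih =>
    have hN : (0 : ℝ) < m + 1 := by positivity
    simp only [run, expect, PMF.bind_apply, tsum_fintype, PMF.uniformOfFintype_apply, ih]
    rw [ENNReal.ofReal_div_of_pos hN, ENNReal.ofReal_sum_of_nonneg fun z _ => h0 (k z),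
      div_eq_mul_inv, sum_mul]
    refine sum_congr rfl fun j _ => ?_
    rw [mul_comm, Fintype.card_fin, ← Nat.cast_succ, ENNReal.ofReal_natCast]

/-- The probability that the program accepts `f`. -/
noncomputable def acc (f : Cube n → Bool) (p : OracleProg n Bool) : ℝ :=
  expect f p fun x => if x then 1 else 0

theorem acc_nonneg (hf : (ones f).Nonempty) (p : OracleProg n Bool) : 0 ≤ acc f p :=
  expect_nonneg hf fun a => by split_ifs <;> norm_num

theorem acc_le_one (hf : (ones f).Nonempty) (p : OracleProg n Bool) : acc f p ≤ 1 :=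
  expect_le_const hf (always_of_forall _ fun a => by split_ifs <;> norm_num)

theorem acc_bind (p : OracleProg n α) (g : α → OracleProg n Bool) :
    acc f (p >>= g) = expect f p fun a => acc f (g a) := expect_bind _ _ _

theorem acc_true : acc f (pure true : OracleProg n Bool) = 1 := rfl

theorem acc_false : acc f (pure false : OracleProg n Bool) = 0 := by simp [acc, expect_pure]

theorem run_true_of_always (hf : (ones f).Nonempty) {p : OracleProg n Bool}
    (h : Always f p fun b => b = true) : run f hf p true = 1 := by
  rw [run_eq_ofReal_expect, ENNReal.ofReal_eq_one]
  exact (expect_congr (h.mono fun b hb => by simp [hb])).trans (expect_const hf p 1)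

theorem le_run_false (hf : (ones f).Nonempty) {p : OracleProg n Bool} (h : acc f p ≤ 1 / 3) :
    2 / 3 ≤ run f hf p false := by
  rw [run_eq_ofReal_expect]
  have h1 : expect f p (fun x => if x = false then 1 else 0) + acc f p = 1 := by
    rw [acc, ← expect_add]
    refine (expect_congr (always_of_forall p fun x => ?_)).trans (expect_const hf p 1)
    cases x <;> simp
  have h2 : (2 / 3 : ENNReal) = ENNReal.ofReal (2 / 3) := by
    rw [ENNReal.ofReal_div_of_pos (by norm_num)]; norm_num
  rw [h2]
  exact ENNReal.ofReal_le_ofReal (by linarith)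

section uniformFrom

variable {s : Finset (Fin n)} (hs : s.Nonempty)

theorem expect_uniformFrom (φ : Fin n → ℝ) :
    expect f (uniformFrom s hs) φ = (∑ i ∈ s, φ i) / s.card := by
  have hc := Nat.sub_add_cancel hs.card_pos
  simp only [uniformFrom, expect]
  congr 1
  · conv_rhs => rw [← Finset.map_orderEmbOfFin_univ s hc.symm, sum_map]
    rfl
  · exact_mod_cast hc

theorem always_uniformFrom {Q : Fin n → Prop} (h : ∀ i ∈ s, Q i) :
    Always f (uniformFrom s hs) Q := fun _ => h _ (Finset.orderEmbOfFin_mem _ _ _)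

end uniformFrom

/-- The probability that `m` samples all satisfy `P`. -/
theorem expect_samples_forall (hf : (ones f).Nonempty) (P : Cube n → Prop) [DecidablePred P]
    (m : ℕ) :
    expect f (samples m) (fun S => if ∀ x ∈ S, P x then 1 else 0) =
      (avg f fun z => if P z then 1 else 0) ^ m := by
  induction m with
  | zero => simp [samples, expect_pure]
  | succ m ih =>
    simp only [samples, expect_bind, expect_pure, expect_sample, List.forall_mem_cons]
    rw [pow_succ', mul_comm, ← avg_const_mul, ← ih]
    refine avg_congr fun z _ => ?_
    by_cases hz : P z
    · simp [hz]
    · simp [hz, expect_const hf]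

/-- The second moment of a sum of independent centered variables. -/
theorem expect_samples_sq (hf : (ones f).Nonempty) (c : Cube n → ℝ) (hc : avg f c = 0) (m : ℕ) :
    expect f (samples m) (fun S => (S.map c).sum) = 0 ∧
    expect f (samples m) (fun S => (S.map c).sum ^ 2) = m * avg f fun z => c z ^ 2 := by
  induction m with
  | zero => simp [samples, expect_pure]
  | succ m ih =>
    have e1 : ∀ z, expect f (samples m) (fun S => ((z :: S).map c).sum) = c z := fun z => by
      simp only [List.map_cons, List.sum_cons, expect_add, ih.1, expect_const hf, add_zero]
    have e2 : ∀ z, expect f (samples m) (fun S => ((z :: S).map c).sum ^ 2) =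
        c z ^ 2 + m * avg f fun z => c z ^ 2 := fun z => by
      simp only [List.map_cons, List.sum_cons, add_sq, expect_add, ih.2, expect_const hf,
        expect_const_mul, ih.1, mul_zero, add_zero]
    simp only [samples, expect_bind, expect_pure, expect_sample, e1, e2, hc, avg_add,
      avg_const hf, true_and]
    push_cast; ring

theorem maxCalls_bind_le {p : OracleProg n α} {g : α → OracleProg n β} {A B : ℕ}
    (hp : maxCalls f p ≤ A) (hg : Always f p fun a => maxCalls f (g a) ≤ B) :
    maxCalls f (p >>= g) ≤ A + B := by
  refine le_trans ?_ (Nat.add_le_add_right hp B)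
  clear hp
  change maxCalls f (p.andThen g) ≤ _
  induction p with
  | done a => simpa [andThen, maxCalls, Always] using hg
  | samp k ih =>
    simp only [andThen, maxCalls, add_assoc, add_le_add_iff_left]
    refine Finset.sup_le fun z hz => (ih z (hg z hz)).trans ?_
    exact Nat.add_le_add_right (Finset.le_sup (f := fun z => maxCalls f (k z)) hz) B
  | query x k ih =>
    simp only [andThen, maxCalls, add_assoc, add_le_add_iff_left]
    exact ih _ hg
  | toss m k ih =>
    simp only [andThen, maxCalls]
    refine Finset.sup_le fun j hj => (ih j (hg j)).trans ?_
    exact Nat.add_le_add_right (Finset.le_sup (f := fun j => maxCalls f (k j)) hj) B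

theorem maxCalls_bind_le_of_forall {p : OracleProg n α} {g : α → OracleProg n β} {A B : ℕ}
    (hp : maxCalls f p ≤ A) (hg : ∀ a, maxCalls f (g a) ≤ B) :
    maxCalls f (p >>= g) ≤ A + B :=
  maxCalls_bind_le hp (always_of_forall p hg)

theorem maxCalls_pure (a : α) : maxCalls f (pure a : OracleProg n α) = 0 := rfl

theorem maxCalls_sample : maxCalls f sample ≤ 1 := by
  simp [sample, maxCalls]

theorem maxCalls_ask (x : Cube n) : maxCalls f (ask x) ≤ 1 := by simp [ask, maxCalls]

theorem maxCalls_samples (m : ℕ) : maxCalls f (samples m) ≤ m := by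
  induction m with
  | zero => exact le_rfl
  | succ m ih =>
    refine (maxCalls_bind_le_of_forall maxCalls_sample fun z => ?_).trans_eq (add_comm 1 m)
    exact maxCalls_bind_le_of_forall (B := 0) ih fun S => (maxCalls_pure _).le

theorem maxCalls_askAll (xs : List (Cube n)) : maxCalls f (askAll xs) ≤ xs.length := by
  induction xs with
  | nil => exact le_rfl
  | cons x xs ih =>
    refine (maxCalls_bind_le_of_forall (maxCalls_ask x) fun z => ?_).trans_eq (add_comm 1 _)
    exact maxCalls_bind_le_of_forall (B := 0) ih fun S => (maxCalls_pure _).le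

theorem maxCalls_uniformFrom {s : Finset (Fin n)} (hs : s.Nonempty) :
    maxCalls f (uniformFrom s hs) = 0 := by
  simp [uniformFrom, maxCalls]

theorem acc_runAll_cons (p : OracleProg n Bool) (ps : List (OracleProg n Bool)) :
    acc f (runAll (p :: ps)) = acc f p * acc f (runAll ps) := by
  rw [runAll, acc_bind, acc, ← expect_mul_const]
  congr 1; funext b; cases b <;> simp [acc_false]

theorem acc_runAll (ps : List (OracleProg n Bool)) :
    acc f (runAll ps) = (ps.map (acc f)).prod := by
  induction ps with
  | nil => rfl
  | cons p ps ih => rw [acc_runAll_cons, ih, List.map_cons, List.prod_cons]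

theorem always_runAll {ps : List (OracleProg n Bool)}
    (h : ∀ p ∈ ps, Always f p fun b => b = true) : Always f (runAll ps) fun b => b = true := by
  induction ps with
  | nil => rfl
  | cons p ps ih =>
    rw [runAll, always_bind]
    refine (h p (by simp)).mono ?_
    rintro b rfl
    simpa using ih fun q hq => h q (by simp [hq])

theorem maxCalls_runAll {ps : List (OracleProg n Bool)} :
    maxCalls f (runAll ps) ≤ (ps.map (maxCalls f)).sum := by
  induction ps with
  | nil => exact le_rfl
  | cons p ps ih =>
    refine maxCalls_bind_le_of_forall le_rfl fun b => ?_
    cases b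
    · simp [maxCalls_pure]
    · exact ih

end OracleProg

end RelUnate

namespace RelUnate

open OracleProg Finset

variable {n : ℕ}

theorem flipBit_same (x : Cube n) (i : Fin n) : flipBit x i i = !x i := by simp [flipBit]

theorem flipBit_of_ne (x : Cube n) {i j : Fin n} (h : j ≠ i) : flipBit x i j = x j := by
  simp [flipBit, h]

theorem flipBit_flipBit (x : Cube n) (i : Fin n) : flipBit (flipBit x i) i = x := by
  simp [flipBit]

theorem flipBit_comm (x : Cube n) (i j : Fin n) :
    flipBit (flipBit x i) j = flipBit (flipBit x j) i := by
  rcases eq_or_ne i j with rfl | h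
  · rfl
  · simp only [flipBit, Function.update_of_ne h, Function.update_of_ne h.symm]
    exact Function.update_comm h.symm _ _ _ |>.symm

theorem update_eq_self_or_flipBit (x : Cube n) (i : Fin n) (b : Bool) :
    Function.update x i b = if x i = b then x else flipBit x i := by
  split_ifs with h
  · rw [← h, Function.update_eq_self]
  · rw [flipBit]; congr 1; revert h; cases x i <;> cases b <;> simp

/-- The flip of the `i`-th bit as a permutation of the cube. -/
def flipPerm (i : Fin n) : Equiv.Perm (Cube n) :=
  Function.Involutive.toPerm (fun x => flipBit x i) fun x => flipBit_flipBit x i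

theorem flipPerm_apply (i : Fin n) (x : Cube n) : flipPerm i x = flipBit x i := rfl

/-- The points `z` of `f⁻¹(1)` with `z i = b` and `f (z^{(i)}) = 0`. -/
def boundary (f : Cube n → Bool) (i : Fin n) (b : Bool) : Finset (Cube n) :=
  (ones f).filter fun z => z i = b ∧ f (flipBit z i) = false

theorem mem_boundary {f : Cube n → Bool} {i : Fin n} {b : Bool} {z : Cube n} :
    z ∈ boundary f i b ↔ f z = true ∧ z i = b ∧ f (flipBit z i) = false := by
  simp [boundary, mem_ones]

theorem monotoneInDir_iff {f : Cube n → Bool} {i : Fin n} {b : Bool} :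
    MonotoneInDir f i b ↔ boundary f i (!b) = ∅ := by
  simp only [MonotoneInDir, eq_empty_iff_forall_notMem, mem_boundary]
  constructor
  · rintro h z ⟨h1, h2, h3⟩
    have := h z
    simp only [update_eq_self_or_flipBit, h2, if_true] at this
    rw [if_neg (by cases b <;> simp)] at this
    rw [h1, h3] at this
    exact absurd this (by decide)
  · intro h x
    by_contra hx
    apply h (Function.update x i !b)
    refine ⟨?_, by simp, ?_⟩
    · cases h1 : f (Function.update x i !b)
      · simp [h1] at hx
      · rfl
    · rw [flipBit]
      simp only [Function.update_self, Function.update_idem, Bool.not_not]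
      cases h1 : f (Function.update x i b)
      · rfl
      · exact absurd le_top (h1 ▸ hx)

/-- Sort `f` along every edge in direction `i`, moving the ones to the side `b`. -/
def shift (f : Cube n → Bool) (i : Fin n) (b : Bool) : Cube n → Bool := fun x =>
  if x i = b then f x || f (flipBit x i) else f x && f (flipBit x i)

theorem card_symmDiff_shift_le (f : Cube n → Bool) (i : Fin n) (b : Bool) :
    (symmDiff (ones f) (ones (shift f i b))).card ≤ 2 * (boundary f i (!b)).card := by
  classical
  have hsub : symmDiff (ones f) (ones (shift f i b)) ⊆
      boundary f i (!b) ∪ (boundary f i (!b)).image (flipPerm i) := by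
    intro x hx
    rw [mem_symmDiff, mem_ones, mem_ones] at hx
    by_cases h : x i = b
    · refine mem_union_right _ (mem_image.2 ⟨flipBit x i, ?_, flipBit_flipBit x i⟩)
      rw [mem_boundary, flipBit_same, flipBit_flipBit, h]
      simp only [shift, h, if_true] at hx
      revert hx
      cases f x <;> cases f (flipBit x i) <;> simp
    · refine mem_union_left _ (mem_boundary.2 ?_)
      simp only [shift, h, if_false] at hx
      revert hx h
      cases f x <;> cases f (flipBit x i) <;> cases x i <;> cases b <;> simp
  calc _ ≤ _ := card_le_card hsub
    _ ≤ _ := card_union_le _ _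
    _ ≤ _ := by rw [two_mul]; exact Nat.add_le_add_left card_image_le _

theorem boundary_shift_self (f : Cube n → Bool) (i : Fin n) (b : Bool) :
    boundary (shift f i b) i (!b) = ∅ := by
  simp only [eq_empty_iff_forall_notMem, mem_boundary, shift, flipBit_same, flipBit_flipBit]
  rintro x ⟨h1, h2, h3⟩
  rw [h2] at h1 h3
  revert h1 h3
  cases f x <;> cases f (flipBit x i) <;> cases b <;> simp

theorem card_boundary_shift_le (f : Cube n → Bool) {i j : Fin n} (hij : j ≠ i) (b c : Bool) :
    (boundary (shift f i b) j c).card ≤ (boundary f j c).card := by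
  have key : ∀ g : Cube n → Bool, 2 * (boundary g j c).card = ∑ x : Cube n,
      ((if g x = true ∧ x j = c ∧ g (flipBit x j) = false then 1 else 0) +
      if g (flipBit x i) = true ∧ x j = c ∧ g (flipBit (flipBit x i) j) = false then 1 else 0) := by
    intro g
    have h1 : (boundary g j c).card =
        ∑ x : Cube n, if g x = true ∧ x j = c ∧ g (flipBit x j) = false then 1 else 0 := by
      rw [← card_filter]; congr 1; ext z; simp [mem_boundary]
    rw [sum_add_distrib, ← h1, two_mul, add_right_inj, h1, ← Equiv.sum_comp (flipPerm i)]
    refine sum_congr rfl fun x _ => ?_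
    simp only [flipPerm_apply, flipBit_of_ne x hij]
  suffices h : 2 * (boundary (shift f i b) j c).card ≤ 2 * (boundary f j c).card by omega
  rw [key, key]
  clear key
  refine sum_le_sum ?_
  rintro x -
  have e : flipBit (flipBit (flipBit x i) j) i = flipBit x j := by
    rw [flipBit_comm _ j i, flipBit_flipBit]
  simp only [shift, flipBit_same, flipBit_flipBit, flipBit_of_ne _ hij.symm, flipBit_comm x j i, e]
  clear e hij
  generalize f x = p, f (flipBit x i) = q, f (flipBit x j) = r, f (flipBit (flipBit x i) j) = s,
    x i = y, x j = z
  clear x i j f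
  revert p q r s y z b c
  decide

/-- A function can be made monotone in given directions by modifying at most twice as many values
as there are violating edges. -/
theorem exists_monotone_near (f : Cube n → Bool) (c : Fin n → Bool) (s : Finset (Fin n)) :
    ∃ g : Cube n → Bool, (∀ i ∈ s, boundary g i (!c i) = ∅) ∧
      (∀ i, (boundary g i (!c i)).card ≤ (boundary f i (!c i)).card) ∧
      (symmDiff (ones f) (ones g)).card ≤ 2 * ∑ i ∈ s, (boundary f i (!c i)).card := by
  classical
  induction s using Finset.induction_on with
  | empty => exact ⟨f, by simp, fun _ => le_rfl, by simp⟩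
  | insert i s hi ih =>
    obtain ⟨g, h1, h2, h3⟩ := ih
    have h4 : ∀ j, (boundary (shift g i (c i)) j (!c j)).card ≤ (boundary g j (!c j)).card := by
      intro j
      rcases eq_or_ne j i with rfl | hj
      · simp [boundary_shift_self]
      · exact card_boundary_shift_le g hj _ _
    refine ⟨shift g i (c i), ?_, fun j => (h4 j).trans (h2 j), ?_⟩
    · intro j hj
      rcases mem_insert.1 hj with rfl | hj
      · exact boundary_shift_self _ _ _
      · exact card_eq_zero.1 (Nat.le_zero.1 ((h4 j).trans_eq (card_eq_zero.2 (h1 j hj))))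
    · rw [sum_insert hi]
      have h5 := card_symmDiff_shift_le g i (c i)
      have h6 := h2 i
      have h7 : (symmDiff (ones f) (ones (shift g i (c i)))).card ≤ _ :=
        (card_le_card (symmDiff_triangle (ones f) (ones g) _)).trans (card_union_le _ _)
      omega

/-- The number of values to be modified to make `f` unate, in terms of the edges of `f`. -/
theorem exists_unate_near (f : Cube n → Bool) :
    ∃ g : Cube n → Bool, Unate g ∧ (symmDiff (ones f) (ones g)).card ≤
      2 * ∑ i, min (boundary f i false).card (boundary f i true).card := by
  obtain ⟨g, h1, -, h3⟩ := exists_monotone_near f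
    (fun i => decide ((boundary f i false).card ≤ (boundary f i true).card)) univ
  refine ⟨g, fun i => ?_, h3.trans_eq ?_⟩
  · rw [monotoneInDir_iff, monotoneInDir_iff]
    have := h1 i (mem_univ i)
    cases h : decide ((boundary f i false).card ≤ (boundary f i true).card)
    · right; rwa [h] at this
    · left; rwa [h] at this
  · congr 1
    refine sum_congr rfl fun i _ => ?_
    by_cases h : (boundary f i false).card ≤ (boundary f i true).card
    · simp [h]
    · simp [h, (not_le.1 h).le]

theorem le_card_symmDiff {f g : Cube n → Bool} {ε : ℝ} (hf : (ones f).Nonempty)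
    (hε : ε ≤ reldistTo f {g | Unate g}) (hg : Unate g) :
    ε * (ones f).card ≤ (symmDiff (ones f) (ones g)).card := by
  have hN : (0 : ℝ) < (ones f).card := by exact_mod_cast hf.card_pos
  rw [← le_div_iff₀ hN]
  refine hε.trans (csInf_le ⟨0, ?_⟩ ⟨g, hg, rfl⟩)
  rintro _ ⟨g, -, rfl⟩
  exact div_nonneg (Nat.cast_nonneg _) (Nat.cast_nonneg _)

theorem hammingDist_flipBit_le (z a : Cube n) (i : Fin n) :
    hammingDist (flipBit z i) a ≤ hammingDist z a + 1 := by
  have h : (univ.filter fun j => flipBit z i j ≠ a j) ⊆ insert i (univ.filter fun j => z j ≠ a j) := by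
    intro j hj
    rcases eq_or_ne j i with rfl | hji
    · simp
    · simpa [hji, flipBit_of_ne z hji] using hj
  exact (card_le_card h).trans (card_insert_le _ _)

theorem hammingDist_flipBit_le_of_eq {z a : Cube n} {i : Fin n} (h : flipBit z i i = a i) :
    hammingDist (flipBit z i) a ≤ hammingDist z a := by
  refine card_le_card fun j hj => ?_
  rcases eq_or_ne j i with rfl | hji
  · simp [h] at hj
  · simpa [flipBit_of_ne z hji] using hj

/-- The restriction of `f⁻¹(1)` to the ball of radius `R` around `a`. -/
def truncate (f : Cube n → Bool) (a : Cube n) (R : ℕ) : Cube n → Bool := fun x =>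
  f x && decide (hammingDist x a ≤ R)

/-- The points of `boundary f i b` in the ball of radius `R` around `a`. -/
def nearBoundary (f : Cube n → Bool) (a : Cube n) (R : ℕ) (i : Fin n) (b : Bool) :
    Finset (Cube n) :=
  (boundary f i b).filter fun z => hammingDist z a ≤ R

/-- The points of `f⁻¹(1)` on the sphere of radius `R` around `a`. -/
def sphereOnes (f : Cube n → Bool) (a : Cube n) (R : ℕ) : Finset (Cube n) :=
  (ones f).filter fun z => hammingDist z a = R

theorem card_boundary_truncate_le (f : Cube n → Bool) (a : Cube n) (R : ℕ) (i : Fin n) (b : Bool) :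
    (boundary (truncate f a R) i b).card ≤ (nearBoundary f a R i b).card +
      ((sphereOnes f a (R + 1)).filter fun y => y i ≠ a i).card := by
  classical
  have hsub : boundary (truncate f a R) i b ⊆ nearBoundary f a R i b ∪
      ((sphereOnes f a (R + 1)).filter fun y => y i ≠ a i).image (flipPerm i) := by
    intro z hz
    simp only [mem_boundary, truncate, Bool.and_eq_true, decide_eq_true_eq, Bool.and_eq_false_iff,
      decide_eq_false_iff_not, not_le] at hz
    obtain ⟨⟨h1, h2⟩, h3, h4⟩ := hz
    cases h5 : f (flipBit z i)
    · exact mem_union_left _ (mem_filter.2 ⟨mem_boundary.2 ⟨h1, h3, h5⟩, h2⟩)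
    · have h6 : R < hammingDist (flipBit z i) a := by simpa [h5] using h4
      refine mem_union_right _ (mem_image.2 ⟨flipBit z i, ?_, flipBit_flipBit z i⟩)
      have h7 := hammingDist_flipBit_le z a i
      refine mem_filter.2 ⟨mem_filter.2 ⟨mem_ones.2 h5, by omega⟩, fun h => ?_⟩
      have := hammingDist_flipBit_le_of_eq h
      omega
  exact (card_le_card hsub).trans ((card_union_le _ _).trans (Nat.add_le_add_left card_image_le _))

theorem sum_card_sphereOnes (f : Cube n → Bool) (a : Cube n) (R : ℕ) :
    ∑ i, ((sphereOnes f a R).filter fun y => y i ≠ a i).card = R * (sphereOnes f a R).card := by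
  simp only [card_filter]
  rw [sum_comm, mul_comm, ← smul_eq_mul]
  refine sum_eq_card_nsmul fun y hy => ?_
  rw [← card_filter]
  exact (mem_filter.1 hy).2

theorem exists_sphere_small (f : Cube n → Bool) (a : Cube n) {K : ℕ} (hK : 0 < K) :
    ∃ R, R + 1 ≤ 2 * K ∧ K ≤ R ∧ K * (sphereOnes f a (R + 1)).card ≤
      ((ones f).filter fun z => K < hammingDist z a).card := by
  classical
  by_contra! H
  have h1 : ∑ R ∈ Ico K (2 * K), (sphereOnes f a (R + 1)).card ≤
      ((ones f).filter fun z => K < hammingDist z a).card := by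
    rw [← card_biUnion]
    · refine card_le_card fun z hz => ?_
      obtain ⟨R, hR, hz⟩ := mem_biUnion.1 hz
      obtain ⟨h1, h2⟩ := mem_filter.1 hz
      exact mem_filter.2 ⟨h1, by rw [h2]; have := (mem_Ico.1 hR).1; omega⟩
    · intro R _ R' _ hne
      refine disjoint_left.2 fun z hz hz' => hne ?_
      have h1 := (mem_filter.1 hz).2
      have h2 := (mem_filter.1 hz').2
      omega
  have h2 : ∑ R ∈ Ico K (2 * K), ((ones f).filter fun z => K < hammingDist z a).card <
      ∑ R ∈ Ico K (2 * K), K * (sphereOnes f a (R + 1)).card :=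
    sum_lt_sum_of_nonempty (by simp [hK]) fun R hR => by
      rw [mem_Ico] at hR
      exact H R (by omega) hR.1
  rw [sum_const, Nat.card_Ico, ← mul_sum, smul_eq_mul,
    show 2 * K - K = K by omega] at h2
  exact absurd h1 (not_le.2 (lt_of_mul_lt_mul_left h2 (Nat.zero_le _)))

/-- If few points of `f⁻¹(1)` are at distance more than `K` from `a` and `f` is far from unate,
then many edges close to `a` violate unateness. -/
theorem exists_radius {f : Cube n → Bool} (hf : (ones f).Nonempty) (a : Cube n) {K : ℕ} {ε : ℝ}
    (hK : 0 < K) (hε : ε ≤ reldistTo f {g | Unate g})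
    (hfar : (((ones f).filter fun z => K < hammingDist z a).card : ℝ) ≤ ε / 10 * (ones f).card) :
    ∃ R ≤ 2 * K, ε / 4 * (ones f).card ≤
      ∑ i, min ((nearBoundary f a R i false).card : ℝ) (nearBoundary f a R i true).card := by
  classical
  obtain ⟨R, hR1, hR2, hR3⟩ := exists_sphere_small f a hK
  refine ⟨R, by omega, ?_⟩
  set F := ((ones f).filter fun z => K < hammingDist z a).card
  obtain ⟨g, hg, hd⟩ := exists_unate_near (truncate f a R)
  have h1 := le_card_symmDiff hf hε hg
  have h2 : (symmDiff (ones f) (ones (truncate f a R))).card ≤ F := by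
    refine card_le_card fun z hz => ?_
    simp only [mem_symmDiff, mem_ones, truncate, Bool.and_eq_true, decide_eq_true_eq] at hz
    refine mem_filter.2 ⟨mem_ones.2 (by tauto), ?_⟩
    by_contra h
    have : hammingDist z a ≤ R := by omega
    tauto
  have h3 : (symmDiff (ones f) (ones g)).card ≤ _ :=
    (card_le_card (symmDiff_triangle (ones f) (ones (truncate f a R)) _)).trans
      (card_union_le _ _)
  have h4 : ∑ i, min (boundary (truncate f a R) i false).card
      (boundary (truncate f a R) i true).card ≤
      ∑ i, min (nearBoundary f a R i false).card (nearBoundary f a R i true).card +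
        (R + 1) * (sphereOnes f a (R + 1)).card := by
    rw [← sum_card_sphereOnes, ← sum_add_distrib]
    refine sum_le_sum fun i _ => ?_
    have := card_boundary_truncate_le f a R i false
    have := card_boundary_truncate_le f a R i true
    omega
  have h5 : (R + 1) * (sphereOnes f a (R + 1)).card ≤ 2 * F :=
    (Nat.mul_le_mul_right _ hR1).trans (by rw [mul_assoc]; omega)
  have h6 : (symmDiff (ones f) (ones g)).card ≤
      5 * F + 2 * ∑ i, min (nearBoundary f a R i false).card (nearBoundary f a R i true).card := by
    omega
  have h7 : ((symmDiff (ones f) (ones g)).card : ℝ) ≤ 5 * F +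
      2 * ∑ i, min ((nearBoundary f a R i false).card : ℝ) (nearBoundary f a R i true).card := by
    exact_mod_cast h6
  linarith

end RelUnate

namespace RelUnate

open OracleProg Finset

variable {n : ℕ} {f : Cube n → Bool}

/-- Query all `i`-neighbours of the points of `S`, and reject iff edges violating monotonicity in
both directions are found. -/
def pairTest (i : Fin n) (S : List (Cube n)) : OracleProg n Bool := do
  let vs ← askAll (S.map fun z => flipBit z i)
  if (∃ p ∈ S.zip vs, p.1 i = false ∧ p.2 = false) ∧
      (∃ q ∈ S.zip vs, q.1 i = true ∧ q.2 = false)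
  then pure false else pure true

theorem unbiasedStep_eq (d : PString n) (h : (unfixedCoords d).Nonempty) (r : ℕ) :
    unbiasedStep d h r = uniformFrom (unfixedCoords d) h >>= fun i =>
      samples (3 * 2 ^ r) >>= fun S => pairTest i S := rfl

/-- An iteration of the loop of BiasedTest that makes all its calls in advance. -/
def parBiasedStep (t : ℕ) (d : PString n) : OracleProg n Bool := do
  let z ← sample
  let S ← samples t
  if h : (diffSet z d).Nonempty then do
    let i ← uniformFrom (diffSet z d) h
    pairTest i (z :: S)
  else pure true

/-- An iteration of the loop of UnbiasedTest with a fixed number of samples. -/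
def parUnbiasedStep (d : PString n) (r : ℕ) : OracleProg n Bool :=
  if h : (unfixedCoords d).Nonempty then unbiasedStep d h r
  else do
    let _ ← samples (3 * 2 ^ r)
    pure true

/-- Run all tests and take the conjunction of their outputs and of `b`. -/
def conj (b : Bool) : List (OracleProg n Bool) → OracleProg n Bool
  | [] => pure b
  | p :: ps => do
      let x ← p
      let y ← conj b ps
      pure (x && y)

/-- The tests run by the non-adaptive algorithm; `l` stands for `log N`. -/
noncomputable def parSteps (l ε' : ℝ) (d : PString n) : List (OracleProg n Bool) :=
  List.replicate (10 * ⌈5 * l / ε'⌉₊) (parBiasedStep 25 d) ++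
    ((List.range (⌈Real.logb 2 (8 * l / ε')⌉₊ + 2)).map fun j =>
      List.replicate ⌈50 * (8 * l) / (ε' * 2 ^ (j + 1))⌉₊ (parUnbiasedStep d (j + 1))).flatten

open Classical in
/-- A sequential form of the non-adaptive algorithm. -/
noncomputable def parTester (n N : ℕ) (ε : ℝ) : OracleProg n Bool :=
  if N ≤ 1 then pure true
  else do
    let a ← sample
    let S ← samples ⌈400 * Real.logb 2 N⌉₊
    let T ← samples ⌈30 / ε⌉₊
    conj (decide (∀ x ∈ S ++ T, (hammingDist x a : ℝ) ≤ 2 * Real.logb 2 N))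
      (parSteps (Real.logb 2 N) (ε / 64) (biasVector S))

theorem acc_conj (b : Bool) (ps : List (OracleProg n Bool)) :
    acc f (conj b ps) = (if b then 1 else 0) * (ps.map (acc f)).prod := by
  induction ps with
  | nil => simp [conj, acc, expect_pure]
  | cons p ps ih =>
    rw [conj, acc_bind, List.map_cons, List.prod_cons, mul_left_comm, ← ih, acc,
      ← expect_mul_const]
    congr 1; funext x
    rw [acc_bind, acc, ← expect_const_mul]
    congr 1; funext y
    cases x <;> cases y <;> simp [acc, expect_pure]

theorem always_conj {ps : List (OracleProg n Bool)} {b : Bool} (hb : b = true)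
    (h : ∀ p ∈ ps, Always f p fun b => b = true) : Always f (conj b ps) fun b => b = true := by
  induction ps with
  | nil => exact hb
  | cons p ps ih =>
    rw [conj, always_bind]
    refine (h p (by simp)).mono ?_
    rintro b rfl
    rw [always_bind]
    refine (ih fun q hq => h q (by simp [hq])).mono ?_
    rintro b rfl
    rfl

theorem mem_boundary_of_sample {z : Cube n} {i : Fin n} (hz : f z = true)
    (h : f (flipBit z i) = false) : z ∈ boundary f i (z i) := mem_boundary.2 ⟨hz, rfl, h⟩

theorem exists_zip_iff (S : List (Cube n)) (i : Fin n) (b : Bool) :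
    (∃ p ∈ S.zip ((S.map fun z => flipBit z i).map f), p.1 i = b ∧ p.2 = false) ↔
      ∃ z ∈ S, z i = b ∧ f (flipBit z i) = false := by
  rw [List.map_map, ← List.map_id S, List.map_map, List.zip_map']
  simp

/-! ### Unate functions -/

theorem Unate.boundary_eq_empty (hf : Unate f) (i : Fin n) (b : Bool) :
    boundary f i b = ∅ ∨ boundary f i (!b) = ∅ := by
  have := hf i
  rw [monotoneInDir_iff, monotoneInDir_iff] at this
  cases b <;> tauto

theorem two_pow_hammingDist_le {c : Cube n} (hc : ∀ i, MonotoneInDir f i (c i)) {x : Cube n}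
    (hx : f x = true) : 2 ^ hammingDist x c ≤ (ones f).card := by
  classical
  have h1 : ∀ s : Finset (Fin n), f (s.piecewise c x) = true := by
    intro s
    induction s using Finset.induction_on with
    | empty => simpa using hx
    | insert i s hi ih =>
      rw [piecewise_insert]
      have h := hc i (s.piecewise c x)
      rw [update_eq_self_or_flipBit, update_eq_self_or_flipBit] at h
      rw [update_eq_self_or_flipBit]
      split_ifs with h'
      · exact ih
      · have e : s.piecewise c x i = !c i := by
          revert h'; cases s.piecewise c x i <;> cases c i <;> simp
        rw [if_pos e, if_neg h', ih] at h
        exact top_le_iff.1 h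
  rw [hammingDist, ← card_powerset]
  refine card_le_card_of_injOn (fun s => s.piecewise c x) (fun s _ => mem_ones.2 (h1 s)) ?_
  intro s hs t ht hst
  have key : ∀ s ∈ (univ.filter fun i => x i ≠ c i).powerset, ∀ i,
      i ∈ s ↔ x i ≠ c i ∧ s.piecewise c x i = c i := by
    intro s hs i
    rw [mem_powerset] at hs
    constructor
    · intro hi
      exact ⟨(mem_filter.1 (hs hi)).2, piecewise_eq_of_mem _ _ _ hi⟩
    · rintro ⟨h1, h2⟩
      by_contra hi
      rw [piecewise_eq_of_notMem _ _ _ hi] at h2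
      exact h1 h2
  ext i
  rw [key s hs, key t ht]
  simp only at hst
  rw [hst]

theorem Unate.hammingDist_le (hf : Unate f) {x a : Cube n} (hx : f x = true) (ha : f a = true) :
    (hammingDist x a : ℝ) ≤ 2 * Real.logb 2 (ones f).card := by
  have h : ∀ i, ∃ b, MonotoneInDir f i b := fun i => (hf i).elim (fun h => ⟨_, h⟩) fun h => ⟨_, h⟩
  choose c hc using h
  have key : ∀ x, f x = true → (hammingDist x c : ℝ) ≤ Real.logb 2 (ones f).card := by
    intro x hx
    have h := two_pow_hammingDist_le hc hx
    rw [Real.le_logb_iff_rpow_le (by norm_num)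
      (by exact_mod_cast (Nat.pow_pos (n := hammingDist x c) two_pos).trans_le h), Real.rpow_natCast]
    exact_mod_cast h
  have h1 : (hammingDist x a : ℝ) ≤ hammingDist x c + hammingDist a c := by
    rw [hammingDist_comm a c]; exact_mod_cast hammingDist_triangle x c a
  linarith [key x hx, key a ha]

theorem always_confirmDirection {i : Fin n} {b : Bool} (h : boundary f i b = ∅) (t : ℕ) :
    Always f (confirmDirection i b t) fun v => v = false := by
  induction t with
  | zero => rfl
  | succ t ih =>
    simp only [confirmDirection, always_bind, always_sample, always_ask]
    intro z hz
    rw [if_neg]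
    · exact ih
    · rintro ⟨h1, h2⟩
      have := mem_boundary_of_sample (mem_ones.1 hz) h2
      simp [h1, h] at this

theorem always_biasedStep (hf : Unate f) (d : PString n) :
    Always f (biasedStep d) fun v => v = true := by
  simp only [biasedStep, always_bind, always_sample]
  intro z hz
  split_ifs with h
  · rw [always_bind]
    refine always_uniformFrom _ fun i _ => ?_
    rw [always_bind, always_ask]
    split_ifs with hv
    · rw [always_bind]
      have h1 := mem_boundary_of_sample (mem_ones.1 hz) hv
      have h2 := (hf.boundary_eq_empty i (z i)).resolve_left (ne_empty_of_mem h1)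
      refine (always_confirmDirection h2 25).mono ?_
      rintro v rfl
      rfl
    · rfl
  · rfl

theorem always_pairTest (hf : Unate f) (i : Fin n) {S : List (Cube n)}
    (hS : ∀ z ∈ S, f z = true) : Always f (pairTest i S) fun v => v = true := by
  rw [pairTest, always_bind, always_askAll, if_neg]
  · rfl
  · rw [exists_zip_iff, exists_zip_iff]
    rintro ⟨⟨z, hz, h1, h2⟩, w, hw, h3, h4⟩
    have h5 := mem_boundary_of_sample (hS z hz) h2
    have h6 := mem_boundary_of_sample (hS w hw) h4
    rw [h1] at h5
    rw [h3] at h6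
    exact (hf.boundary_eq_empty i false).elim (ne_empty_of_mem h5) (ne_empty_of_mem h6)

theorem always_unbiasedStep (hf : Unate f) (d : PString n) (h : (unfixedCoords d).Nonempty)
    (r : ℕ) : Always f (unbiasedStep d h r) fun v => v = true := by
  simp only [unbiasedStep_eq, always_bind]
  exact always_uniformFrom _ fun i _ => (always_samples _).mono fun S hS =>
    always_pairTest hf i hS.2

theorem always_parBiasedStep (hf : Unate f) (t : ℕ) (d : PString n) :
    Always f (parBiasedStep t d) fun v => v = true := by
  simp only [parBiasedStep, always_bind, always_sample]
  intro z hz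
  refine (always_samples t).mono fun S hS => ?_
  split_ifs with h
  · rw [always_bind]
    exact always_uniformFrom _ fun i _ => always_pairTest hf i
      (List.forall_mem_cons.2 ⟨mem_ones.1 hz, hS.2⟩)
  · rfl

theorem always_parUnbiasedStep (hf : Unate f) (d : PString n) (r : ℕ) :
    Always f (parUnbiasedStep d r) fun v => v = true := by
  rw [parUnbiasedStep]
  split_ifs with h
  · exact always_unbiasedStep hf d h r
  · rw [always_bind]
    exact always_of_forall _ fun _ => rfl

theorem always_unatenessTesterKnownN (hf : Unate f) (ε : ℝ) :
    Always f (unatenessTesterKnownN n (ones f).card ε) fun v => v = true := by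
  simp only [unatenessTesterKnownN, always_bind, always_sample]
  intro a ha
  have key : ∀ m (S : List (Cube n)), (S.length = m ∧ ∀ x ∈ S, f x = true) →
      ¬ ∃ x ∈ S, 2 * Real.logb 2 (ones f).card < (hammingDist x a : ℝ) := by
    rintro m S ⟨-, hS⟩ ⟨x, hx, h⟩
    exact (hf.hammingDist_le (hS x hx) (mem_ones.1 ha)).not_gt h
  refine (always_samples _).mono fun S hS => ?_
  rw [if_neg (key _ S hS), always_bind]
  refine (always_samples _).mono fun T hT => ?_
  rw [if_neg (key _ T hT)]
  refine always_runAll fun p hp => ?_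
  simp only [List.mem_cons, List.not_mem_nil, or_false] at hp
  rcases hp with rfl | rfl
  · rw [biasedTest]
    split_ifs
    · rfl
    · refine always_runAll fun p hp => ?_
      rw [List.eq_of_mem_replicate hp]
      exact always_biasedStep hf _
  · rw [unbiasedTest]
    split_ifs
    · refine always_runAll fun p hp => ?_
      obtain ⟨j, -, rfl⟩ := List.mem_map.1 hp
      refine always_runAll fun p hp => ?_
      rw [List.eq_of_mem_replicate hp]
      exact always_unbiasedStep hf _ _ _
    · rfl

theorem always_parTester (hf : Unate f) (ε : ℝ) :
    Always f (parTester n (ones f).card ε) fun v => v = true := by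
  rw [parTester]
  split_ifs
  · rfl
  simp only [always_bind, always_sample]
  refine fun a ha => (always_samples _).mono fun S hS => (always_samples _).mono fun T hT =>
    always_conj (decide_eq_true fun x hx => hf.hammingDist_le ?_ (mem_ones.1 ha)) fun p hp => ?_
  · exact (List.mem_append.1 hx).elim (hS.2 x) (hT.2 x)
  · rcases List.mem_append.1 hp with hp | hp
    · rw [List.eq_of_mem_replicate hp]
      exact always_parBiasedStep hf _ _
    · obtain ⟨l, hl, hp⟩ := List.mem_flatten.1 hp
      obtain ⟨j, -, rfl⟩ := List.mem_map.1 hl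
      rw [List.eq_of_mem_replicate hp]
      exact always_parUnbiasedStep hf _ _

end RelUnate

namespace RelUnate

open OracleProg Finset

variable {n : ℕ} {f : Cube n → Bool}

theorem exp_neg_le_one_div {t c : ℝ} (hc : 0 < c) (h : c - 1 ≤ t) : Real.exp (-t) ≤ 1 / c := by
  rw [Real.exp_neg, ← one_div]
  exact one_div_le_one_div_of_le hc (by linarith [Real.add_one_le_exp t])

theorem pow_le_exp_neg {p t : ℝ} {m : ℕ} (h0 : 0 ≤ p) (h : p ≤ 1 - t) :
    p ^ m ≤ Real.exp (-(t * m)) := by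
  calc p ^ m ≤ Real.exp (-t) ^ m := by
        gcongr
        linarith [Real.add_one_le_exp (-t)]
    _ = _ := by rw [← Real.exp_nat_mul]; ring_nf

@[to_additive]
theorem prod_map_range {M : Type} [CommMonoid M] (F : ℕ → M) (L : ℕ) : ((List.range L).map F).prod = ∏ j ∈ range L, F j := by
  induction L with
  | zero => simp
  | succ L ih => rw [List.range_succ, List.map_append, List.prod_append, ih, prod_range_succ]; simp

/-! ### Single tests -/

/-- The probability that a sample is not in `boundary f i b`. -/
noncomputable def missProb (f : Cube n → Bool) (i : Fin n) (b : Bool) : ℝ :=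
  avg f fun z => if ¬ (z i = b ∧ f (flipBit z i) = false) then 1 else 0

theorem missProb_eq (hf : (ones f).Nonempty) (i : Fin n) (b : Bool) :
    missProb f i b = 1 - ((boundary f i b).card : ℝ) / (ones f).card := by
  rw [boundary, ← avg_indicator fun z => z i = b ∧ f (flipBit z i) = false, eq_sub_iff_add_eq,
    missProb, ← avg_add]
  refine (avg_congr fun z _ => ?_).trans (avg_const hf 1)
  split_ifs <;> simp

theorem missProb_nonneg (i : Fin n) (b : Bool) : 0 ≤ missProb f i b :=
  avg_nonneg fun z _ => by split_ifs <;> norm_num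

theorem expect_confirmDirection (i : Fin n) (b : Bool) (t : ℕ) :
    (expect f (confirmDirection i b t) fun y => if y then 0 else 1) = missProb f i b ^ t := by
  induction t with
  | zero => simp [confirmDirection, expect_pure]
  | succ t ih =>
    simp only [confirmDirection, expect_bind, expect_sample, expect_ask]
    rw [pow_succ, missProb, ← avg_const_mul]
    refine avg_congr fun z _ => ?_
    split_ifs <;> simp_all [expect_pure, missProb]

theorem acc_pairTest (i : Fin n) (S : List (Cube n)) :
    acc f (pairTest i S) = if (∃ z ∈ S, z i = false ∧ f (flipBit z i) = false) ∧
      (∃ z ∈ S, z i = true ∧ f (flipBit z i) = false) then 0 else 1 := by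
  rw [pairTest, acc_bind, expect_askAll]
  simp only [exists_zip_iff]
  split_ifs <;> simp [acc_false, acc_true]

theorem expect_pairTest_cons_le (hf : (ones f).Nonempty) {z : Cube n} {i : Fin n}
    (h : f (flipBit z i) = false) (t : ℕ) :
    (expect f (samples t) fun S => acc f (pairTest i (z :: S))) ≤ missProb f i (!z i) ^ t := by
  rw [missProb, ← expect_samples_forall hf]
  refine expect_mono (always_of_forall _ fun S => ?_)
  rw [acc_pairTest]
  by_cases h1 : ∃ w ∈ S, w i = (!z i) ∧ f (flipBit w i) = false
  · rw [if_pos]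
    · split_ifs <;> norm_num
    obtain ⟨w, hw, h2, h3⟩ := h1
    cases hz : z i <;> rw [hz] at h2
    · exact ⟨⟨z, by simp, hz, h⟩, w, by simp [hw], h2, h3⟩
    · exact ⟨⟨w, by simp [hw], h2, h3⟩, z, by simp, hz, h⟩
  · rw [if_pos (fun w hw hw' => h1 ⟨w, hw, hw'⟩)]
    split_ifs <;> norm_num

theorem expect_pairTest_le (hf : (ones f).Nonempty) (i : Fin n) (t : ℕ) :
    (expect f (samples t) fun S => acc f (pairTest i S)) ≤
      missProb f i false ^ t + missProb f i true ^ t := by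
  rw [missProb, missProb, ← expect_samples_forall hf, ← expect_samples_forall hf, ← expect_add]
  refine expect_mono (always_of_forall _ fun S => ?_)
  rw [acc_pairTest]
  by_cases h1 : ∃ w ∈ S, w i = false ∧ f (flipBit w i) = false
  · by_cases h2 : ∃ w ∈ S, w i = true ∧ f (flipBit w i) = false
    · rw [if_pos ⟨h1, h2⟩]
      split_ifs <;> norm_num
    · rw [if_neg (fun h => h2 h.2), if_pos (c := ∀ x ∈ S, ¬(x i = true ∧ _))
        (fun w hw hw' => h2 ⟨w, hw, hw'⟩)]
      split_ifs <;> norm_num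
  · rw [if_neg (fun h => h1 h.1), if_pos (c := ∀ x ∈ S, ¬(x i = false ∧ _))
      (fun w hw hw' => h1 ⟨w, hw, hw'⟩)]
    split_ifs <;> norm_num

theorem acc_biasedStep (d : PString n) :
    acc f (biasedStep d) = avg f fun z => if (diffSet z d).Nonempty then
      (∑ i ∈ diffSet z d, if f (flipBit z i) = false then missProb f i (!z i) ^ 25 else 1) /
        (diffSet z d).card else 1 := by
  rw [biasedStep, acc_bind, expect_sample]
  refine avg_congr fun z _ => ?_
  split_ifs with h
  · rw [acc_bind, expect_uniformFrom]
    congr 1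
    refine sum_congr rfl fun i _ => ?_
    rw [acc_bind, expect_ask]
    split_ifs with h'
    · rw [acc_bind, ← expect_confirmDirection]
      congr 1; funext y
      cases y <;> simp [acc_false, acc_true]
    · rfl
  · rfl

theorem acc_parBiasedStep (hf : (ones f).Nonempty) (t : ℕ) (d : PString n) :
    acc f (parBiasedStep t d) = avg f fun z => if (diffSet z d).Nonempty then
      (∑ i ∈ diffSet z d, expect f (samples t) fun S => acc f (pairTest i (z :: S))) /
        (diffSet z d).card else 1 := by
  rw [parBiasedStep, acc_bind, expect_sample]
  refine avg_congr fun z _ => ?_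
  rw [acc_bind]
  split_ifs with h
  · simp only [acc_bind, expect_uniformFrom, div_eq_mul_inv]
    rw [expect_mul_const, expect_sum _ hf]
  · exact expect_const hf _ 1

/-- The coordinates fixed by `d` to a value that is taken by at least `3/5` of the points of
`f⁻¹(1)`. -/
def goodCoords (f : Cube n → Bool) (d : PString n) : Finset (Fin n) :=
  univ.filter fun i => ∃ b, d i = some b ∧ 3 * (ones f).card ≤ 5 * ((ones f).filter fun z => z i = b).card

/-- The coordinates fixed by `d` to a value that is taken by less than `3/5` of the points of
`f⁻¹(1)`. -/
def badCoords (f : Cube n → Bool) (d : PString n) : Finset (Fin n) :=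
  univ.filter fun i => ∃ b, d i = some b ∧ 5 * ((ones f).filter fun z => z i = b).card < 3 * (ones f).card

theorem sum_goodCoords_add (f : Cube n → Bool) (d : PString n) (w : Fin n → ℝ) :
    ∑ i ∈ goodCoords f d, w i + ∑ i ∈ badCoords f d, w i + ∑ i ∈ unfixedCoords d, w i =
      ∑ i, w i := by
  rw [goodCoords, badCoords, unfixedCoords, sum_filter, sum_filter, sum_filter, ← sum_add_distrib,
    ← sum_add_distrib]
  refine sum_congr rfl fun i _ => ?_
  cases h : d i with
  | none => simp
  | some b =>
    by_cases h' : 3 * (ones f).card ≤ 5 * ((ones f).filter fun z => z i = b).card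
    · simp [h']
    · simp [not_le.1 h', h']

theorem card_filter_le_boundary (f : Cube n → Bool) (i : Fin n) (b : Bool) :
    2 * ((ones f).filter fun z => z i = b).card ≤ (boundary f i b).card + (ones f).card := by
  classical
  have h1 : ((ones f).filter fun z => z i = b) ⊆ boundary f i b ∪
      ((ones f).filter fun z => ¬ z i = b).image (flipPerm i) := by
    intro z hz
    obtain ⟨h1, h2⟩ := mem_filter.1 hz
    cases h : f (flipBit z i)
    · exact mem_union_left _ (mem_boundary.2 ⟨mem_ones.1 h1, h2, h⟩)
    · refine mem_union_right _ (mem_image.2 ⟨flipBit z i, ?_, flipBit_flipBit z i⟩)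
      rw [mem_filter, mem_ones, flipBit_same, h2]
      exact ⟨h, by cases b <;> simp⟩
  have h2 : ((ones f).filter fun z => z i = b).card ≤ _ :=
    (card_le_card h1).trans ((card_union_le _ _).trans (Nat.add_le_add_left card_image_le _))
  have h3 := card_filter_add_card_filter_not (s := ones f) fun z => z i = b
  omega

theorem missProb_pow_le (hf : (ones f).Nonempty) {i : Fin n} {b : Bool}
    (h : 3 * (ones f).card ≤ 5 * ((ones f).filter fun z => z i = b).card) {t : ℕ}
    (ht : 25 ≤ t) : missProb f i b ^ t ≤ 1 / 2 := by
  have hN : (0 : ℝ) < (ones f).card := by exact_mod_cast hf.card_pos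
  have h1 := card_filter_le_boundary f i b
  have h2 : ((ones f).card : ℝ) ≤ 5 * (boundary f i b).card := by
    have : (ones f).card ≤ 5 * (boundary f i b).card := by omega
    exact_mod_cast this
  have h3 : missProb f i b ≤ 4 / 5 := by
    have : 1 / 5 ≤ ((boundary f i b).card : ℝ) / (ones f).card := by
      rw [le_div_iff₀ hN]; linarith
    rw [missProb_eq hf]; linarith
  calc missProb f i b ^ t ≤ (4 / 5) ^ t := pow_le_pow_left₀ (missProb_nonneg i b) h3 t
    _ ≤ (4 / 5) ^ 25 := pow_le_pow_of_le_one (by norm_num) (by norm_num) ht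
    _ ≤ 1 / 2 := by norm_num

theorem mem_diffSet {z : Cube n} {d : PString n} {i : Fin n} :
    i ∈ diffSet z d ↔ d i = some (!z i) := by simp [diffSet]

theorem card_diffSet_le (z a : Cube n) (d : PString n) :
    (diffSet z d).card ≤ hammingDist z a + (diffSet a d).card := by
  classical
  have h : diffSet z d ⊆ (univ.filter fun i => z i ≠ a i) ∪ diffSet a d := by
    intro i hi
    by_cases h : z i = a i
    · exact mem_union_right _ (mem_diffSet.2 (h ▸ mem_diffSet.1 hi))
    · exact mem_union_left _ (by simpa using h)
  exact (card_le_card h).trans (card_union_le _ _)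

/-- A uniformly chosen coordinate of `z Δ d` reveals a violating edge with good probability. -/
theorem avg_diffSet_le (hf : (ones f).Nonempty) {d : PString n} {a : Cube n} {R : ℕ} {D : ℝ}
    {w : Fin n → ℝ} {r : Cube n → Fin n → ℝ} (hD : 0 < D)
    (hR : ∀ z : Cube n, hammingDist z a ≤ R → ((diffSet z d).card : ℝ) ≤ D)
    (hw : ∀ i b, w i ≤ ((nearBoundary f a R i b).card : ℝ) / (ones f).card)
    (hr1 : ∀ z ∈ ones f, ∀ i, r z i ≤ 1)
    (hr2 : ∀ z ∈ ones f, ∀ i ∈ goodCoords f d, i ∈ diffSet z d → f (flipBit z i) = false →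
      r z i ≤ 1 / 2) :
    (avg f fun z => if (diffSet z d).Nonempty then
      (∑ i ∈ diffSet z d, r z i) / (diffSet z d).card else 1) ≤
      1 - (∑ i ∈ goodCoords f d, w i) / (2 * D) := by
  classical
  let e : Cube n → Fin n → ℝ := fun z i =>
    if i ∈ diffSet z d ∧ f (flipBit z i) = false ∧ hammingDist z a ≤ R then 1 else 0
  have he0 : ∀ z i, 0 ≤ e z i := fun z i => by simp only [e]; split_ifs <;> norm_num
  have h1 : ∀ z ∈ ones f, (if (diffSet z d).Nonempty then
      (∑ i ∈ diffSet z d, r z i) / (diffSet z d).card else 1) +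
        (2 * D)⁻¹ * ∑ i ∈ goodCoords f d, e z i ≤ 1 := by
    intro z hz
    by_cases hzR : hammingDist z a ≤ R ∧ (diffSet z d).Nonempty
    · obtain ⟨hzR, hne⟩ := hzR
      have hc : (0 : ℝ) < (diffSet z d).card := by exact_mod_cast hne.card_pos
      have h2 : ∑ i ∈ goodCoords f d, e z i =
          ∑ i ∈ diffSet z d, if i ∈ goodCoords f d then e z i else 0 := by
        rw [sum_ite_mem]
        refine (sum_subset inter_subset_right fun i hi hi' => ?_).symm
        exact if_neg fun h => hi' (mem_inter.2 ⟨h.1, hi⟩)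
      have h3 : ∑ i ∈ diffSet z d, r z i + 1 / 2 * ∑ i ∈ goodCoords f d, e z i ≤
          (diffSet z d).card := by
        rw [h2, mul_sum, ← sum_add_distrib]
        refine (sum_le_card_nsmul _ _ 1 fun i hi => ?_).trans_eq (by simp)
        have := hr1 z hz i
        by_cases hg : i ∈ goodCoords f d ∧ f (flipBit z i) = false
        · have := hr2 z hz i hg.1 hi hg.2
          simp only [e, hg, hi, hzR, and_self, if_true]
          linarith
        · have : (if i ∈ goodCoords f d then e z i else 0) = 0 := by
            simp only [e]; split_ifs <;> tauto
          rw [this]; linarith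
      have h4 : (2 * D)⁻¹ * ∑ i ∈ goodCoords f d, e z i ≤
          (1 / 2 * ∑ i ∈ goodCoords f d, e z i) / (diffSet z d).card := by
        rw [mul_inv, div_eq_mul_inv, mul_right_comm, ← one_div (2 : ℝ)]
        refine mul_le_mul_of_nonneg_left (inv_anti₀ hc (hR z hzR)) ?_
        have := sum_nonneg fun i (_ : i ∈ goodCoords f d) => he0 z i
        positivity
      rw [if_pos hne]
      calc _ ≤ _ := add_le_add_right h4 _
        _ = (∑ i ∈ diffSet z d, r z i + 1 / 2 * ∑ i ∈ goodCoords f d, e z i) /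
            (diffSet z d).card := by rw [add_div]
        _ ≤ 1 := (div_le_one hc).2 h3
    · have h2 : ∑ i ∈ goodCoords f d, e z i = 0 :=
        sum_eq_zero fun i _ => if_neg fun h => hzR ⟨h.2.2, ⟨i, h.1⟩⟩
      rw [h2, mul_zero, add_zero]
      split_ifs with hne
      · refine div_le_one_of_le₀ ((sum_le_card_nsmul _ _ 1 fun i _ => hr1 z hz i).trans_eq ?_)
          (Nat.cast_nonneg _)
        simp
      · exact le_rfl
  have h2 := avg_le_const hf h1
  rw [avg_add, avg_const_mul] at h2
  have h3 : ∑ i ∈ goodCoords f d, w i ≤ avg f fun z => ∑ i ∈ goodCoords f d, e z i := by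
    rw [avg, sum_comm, sum_div]
    refine sum_le_sum fun i hi => ?_
    obtain ⟨b, hb, -⟩ := (mem_filter.1 hi).2
    refine (hw i (!b)).trans (div_le_div_of_nonneg_right ?_ (Nat.cast_nonneg _))
    simp only [e, sum_boole, Nat.cast_le]
    refine card_le_card fun z hz => ?_
    rw [nearBoundary, mem_filter, mem_boundary] at hz
    rw [mem_filter, mem_diffSet, hb, mem_ones, hz.1.2.1]
    exact ⟨hz.1.1, by simp, hz.1.2.2, hz.2⟩
  have h4 : (∑ i ∈ goodCoords f d, w i) / (2 * D) ≤
      (2 * D)⁻¹ * avg f fun z => ∑ i ∈ goodCoords f d, e z i := by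
    rw [div_eq_inv_mul]
    exact mul_le_mul_of_nonneg_left h3 (by positivity)
  linarith

section mass

variable {d : PString n} {a : Cube n} {R : ℕ} {w : Fin n → ℝ}

theorem acc_biasedStep_le (hf : (ones f).Nonempty) {D : ℝ} (hD : 0 < D)
    (hR : ∀ z : Cube n, hammingDist z a ≤ R → ((diffSet z d).card : ℝ) ≤ D)
    (hw : ∀ i b, w i ≤ ((nearBoundary f a R i b).card : ℝ) / (ones f).card) :
    acc f (biasedStep d) ≤ 1 - (∑ i ∈ goodCoords f d, w i) / (2 * D) := by
  rw [acc_biasedStep]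
  refine avg_diffSet_le hf hD hR hw (fun z _ i => ?_) fun z _ i hi hi' h => ?_
  · split_ifs
    · refine pow_le_one₀ (missProb_nonneg _ _) ?_
      rw [missProb_eq hf, sub_le_self_iff]; positivity
    · exact le_rfl
  · obtain ⟨b, hb, hb'⟩ := (mem_filter.1 hi).2
    rw [mem_diffSet, hb, Option.some_inj] at hi'
    rw [if_pos h, ← hi']
    exact missProb_pow_le hf hb' le_rfl

theorem acc_parBiasedStep_le (hf : (ones f).Nonempty) {t : ℕ} (ht : 25 ≤ t) {D : ℝ} (hD : 0 < D)
    (hR : ∀ z : Cube n, hammingDist z a ≤ R → ((diffSet z d).card : ℝ) ≤ D)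
    (hw : ∀ i b, w i ≤ ((nearBoundary f a R i b).card : ℝ) / (ones f).card) :
    acc f (parBiasedStep t d) ≤ 1 - (∑ i ∈ goodCoords f d, w i) / (2 * D) := by
  rw [acc_parBiasedStep hf]
  refine avg_diffSet_le hf hD hR hw (fun z _ i => ?_) fun z _ i hi hi' h => ?_
  · exact expect_le_const hf (always_of_forall _ fun S => acc_le_one hf _)
  · obtain ⟨b, hb, hb'⟩ := (mem_filter.1 hi).2
    rw [mem_diffSet, hb, Option.some_inj] at hi'
    refine (expect_pairTest_cons_le hf h t).trans ?_
    rw [← hi']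
    exact missProb_pow_le hf hb' ht

/-- The coordinates outside `Fixed(d)` of weight at least `2 ^ (-r)`. -/
noncomputable def heavyCoords (d : PString n) (w : Fin n → ℝ) (r : ℕ) : Finset (Fin n) :=
  open Classical in (unfixedCoords d).filter fun i => (2 ^ r : ℝ)⁻¹ ≤ w i

theorem acc_unbiasedStep_le (hf : (ones f).Nonempty) (h : (unfixedCoords d).Nonempty) (r : ℕ)
    (hw : ∀ i b, w i ≤ ((boundary f i b).card : ℝ) / (ones f).card) :
    acc f (unbiasedStep d h r) ≤
      1 - ((heavyCoords d w r).card : ℝ) / (2 * (unfixedCoords d).card) := by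
  classical
  have hU : (0 : ℝ) < (unfixedCoords d).card := by exact_mod_cast h.card_pos
  simp only [unbiasedStep_eq, acc_bind, expect_uniformFrom]
  have h1 : ∀ i b, (2 ^ r : ℝ)⁻¹ ≤ w i → missProb f i b ^ (3 * 2 ^ r) ≤ 1 / 4 := by
    intro i b hi
    have h2 : missProb f i b ≤ 1 - (2 ^ r : ℝ)⁻¹ := by
      rw [missProb_eq hf]; linarith [hw i b]
    refine (pow_le_exp_neg (missProb_nonneg i b) h2).trans (exp_neg_le_one_div (by norm_num) ?_)
    push_cast
    rw [mul_left_comm, inv_mul_cancel₀ (by positivity)]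
    norm_num
  rw [div_le_iff₀ hU]
  have h3 : (1 - ((heavyCoords d w r).card : ℝ) / (2 * (unfixedCoords d).card)) *
      (unfixedCoords d).card =
      ∑ i ∈ unfixedCoords d, (1 - if (2 ^ r : ℝ)⁻¹ ≤ w i then 1 / 2 else 0) := by
    rw [sum_sub_distrib, ← sum_filter, sum_const, sum_const, heavyCoords]
    simp only [nsmul_eq_mul]
    field_simp
  rw [h3]
  refine sum_le_sum fun i _ => ?_
  split_ifs with hi
  · linarith [expect_pairTest_le hf i (3 * 2 ^ r), h1 i false hi, h1 i true hi]
  · rw [sub_zero]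
    exact expect_le_const hf (always_of_forall _ fun S => acc_le_one hf _)

theorem le_sum_dyadic {x : ℝ} (hx : x ≤ 1) (L : ℕ) :
    x ≤ ∑ j ∈ range L, (if (2 ^ (j + 1) : ℝ)⁻¹ ≤ x then (2 ^ (j + 1) : ℝ)⁻¹ else 0) +
      (2 ^ L : ℝ)⁻¹ := by
  induction L with
  | zero => simpa using hx
  | succ L ih =>
    rw [sum_range_succ]
    split_ifs with h
    · have : (2 ^ L : ℝ)⁻¹ = (2 ^ (L + 1) : ℝ)⁻¹ + (2 ^ (L + 1) : ℝ)⁻¹ := by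
        rw [pow_succ]; field_simp; norm_num
      linarith
    · have : 0 ≤ ∑ j ∈ range L, (if (2 ^ (j + 1) : ℝ)⁻¹ ≤ x then (2 ^ (j + 1) : ℝ)⁻¹ else 0) :=
        sum_nonneg fun j _ => by split_ifs <;> positivity
      linarith

theorem prod_unbiasedStep_le (hf : (ones f).Nonempty) (h : (unfixedCoords d).Nonempty)
    (hw : ∀ i b, w i ≤ ((boundary f i b).card : ℝ) / (ones f).card) {ε' U : ℝ} (hε : 0 < ε')
    (hU : ((unfixedCoords d).card : ℝ) ≤ U) (hW : 8 * ε' ≤ ∑ i ∈ unfixedCoords d, w i) :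
    ∏ j ∈ range (⌈Real.logb 2 (U / ε')⌉₊ + 2),
      acc f (unbiasedStep d h (j + 1)) ^ ⌈50 * U / (ε' * 2 ^ (j + 1))⌉₊ ≤ 1 / 10 := by
  classical
  have hU0 : (0 : ℝ) < (unfixedCoords d).card := by exact_mod_cast h.card_pos
  have hU1 : 0 < U := hU0.trans_le hU
  set L := ⌈Real.logb 2 (U / ε')⌉₊ + 2 with hL
  have hw1 : ∀ i, w i ≤ 1 := fun i => (hw i true).trans
    (div_le_one_of_le₀ (by exact_mod_cast card_filter_le _ _) (Nat.cast_nonneg _))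
  have hLU : U * (2 ^ L : ℝ)⁻¹ ≤ ε' / 4 := by
    have h1 : U / ε' ≤ 2 ^ ⌈Real.logb 2 (U / ε')⌉₊ := by
      rw [← Real.rpow_natCast, ← Real.logb_le_iff_le_rpow (by norm_num) (by positivity)]
      exact Nat.le_ceil _
    rw [div_le_iff₀ hε] at h1
    rw [← div_eq_mul_inv, div_le_iff₀ (by positivity), hL, pow_add]
    linarith
  have h1 : ∀ j, acc f (unbiasedStep d h (j + 1)) ^ ⌈50 * U / (ε' * 2 ^ (j + 1))⌉₊ ≤
      Real.exp (-(25 / ε' * ((heavyCoords d w (j + 1)).card * (2 ^ (j + 1) : ℝ)⁻¹))) := by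
    intro j
    refine (pow_le_exp_neg (acc_nonneg hf _) (acc_unbiasedStep_le hf h (j + 1) hw)).trans ?_
    rw [Real.exp_le_exp, neg_le_neg_iff]
    calc _ = ((heavyCoords d w (j + 1)).card : ℝ) / (2 * U) * (50 * U / (ε' * 2 ^ (j + 1))) := by
          field_simp; ring
      _ ≤ ((heavyCoords d w (j + 1)).card : ℝ) / (2 * (unfixedCoords d).card) *
          ⌈50 * U / (ε' * 2 ^ (j + 1))⌉₊ := by
        gcongr
        exact Nat.le_ceil _
  refine (prod_le_prod (fun j _ => pow_nonneg (acc_nonneg hf _) _) fun j _ => h1 j).trans ?_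
  rw [← Real.exp_sum, sum_neg_distrib, ← mul_sum]
  refine exp_neg_le_one_div (by norm_num) ?_
  have h2 : ∑ i ∈ unfixedCoords d, w i ≤
      ∑ j ∈ range L, (heavyCoords d w (j + 1)).card * (2 ^ (j + 1) : ℝ)⁻¹ + ε' / 4 := by
    calc _ ≤ ∑ i ∈ unfixedCoords d, (∑ j ∈ range L,
          (if (2 ^ (j + 1) : ℝ)⁻¹ ≤ w i then (2 ^ (j + 1) : ℝ)⁻¹ else 0) + (2 ^ L : ℝ)⁻¹) :=
          sum_le_sum fun i _ => le_sum_dyadic (hw1 i) L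
      _ = ∑ j ∈ range L, (heavyCoords d w (j + 1)).card * (2 ^ (j + 1) : ℝ)⁻¹ +
          (unfixedCoords d).card * (2 ^ L : ℝ)⁻¹ := by
          rw [sum_add_distrib, sum_comm, sum_const, nsmul_eq_mul]
          simp only [heavyCoords, ← sum_filter, sum_const, nsmul_eq_mul]
      _ ≤ _ := by
        have : (unfixedCoords d).card * (2 ^ L : ℝ)⁻¹ ≤ U * (2 ^ L : ℝ)⁻¹ := by gcongr
        linarith
  calc (10 - 1 : ℝ) ≤ 25 / ε' * (8 * ε' - ε' / 4) := by field_simp; norm_num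
    _ ≤ _ := by gcongr; linarith

theorem pow_biasedStep_le {p M ε W : ℝ} (hε : 0 < ε) (hM : 0 < M) (hp : 0 ≤ p)
    (hpW : p ≤ 1 - W / (2 * (2 * M))) (hW : ε / 16 ≤ W) :
    p ^ (10 * ⌈M / (ε / 64)⌉₊) ≤ 1 / 10 := by
  have h1 : p ≤ 1 - ε / (64 * M) := by
    have : ε / (64 * M) ≤ W / (2 * (2 * M)) := by
      rw [div_le_div_iff₀ (by positivity) (by positivity)]
      nlinarith
    linarith
  refine (pow_le_exp_neg hp h1).trans (exp_neg_le_one_div (by norm_num) ?_)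
  calc (10 - 1 : ℝ) ≤ ε / (64 * M) * (10 * (M / (ε / 64))) := by field_simp; norm_num
    _ ≤ _ := by push_cast; gcongr; exact Nat.le_ceil _

end mass

end RelUnate

namespace RelUnate

open OracleProg Finset

variable {n : ℕ} {f : Cube n → Bool}

theorem sum_map_sub_const (S : List (Cube n)) (i : Fin n) (μ : ℝ) :
    (S.map fun z => (if z i = true then 1 else 0) - μ).sum =
      (S.countP fun z => z i) - S.length * μ := by
  induction S with
  | nil => simp
  | cons z S ih =>
    rw [List.map_cons, List.sum_cons, ih, List.countP_cons, List.length_cons]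
    split_ifs <;> push_cast <;> ring

/-- Chebyshev's inequality for the estimated bias. -/
theorem expect_mem_badCoords_le (hf : (ones f).Nonempty) (i : Fin n) {m : ℕ} (hm : 400 ≤ m) :
    (expect f (samples m) fun S => if i ∈ badCoords f (biasVector S) then 1 else 0) ≤ 1 / 36 := by
  have hN : (0 : ℝ) < (ones f).card := by exact_mod_cast hf.card_pos
  have hm' : (400 : ℝ) ≤ m := by exact_mod_cast hm
  set μ : ℝ := avg f fun z => if z i = true then 1 else 0 with hμ
  have h1 : ((ones f).filter fun z => z i = true).card = μ * (ones f).card := by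
    rw [hμ, avg_indicator fun z => z i = true]; field_simp
  have h0 : ((ones f).filter fun z => z i = false).card = (1 - μ) * (ones f).card := by
    have h := card_filter_add_card_filter_not (s := ones f) fun z => z i = true
    simp only [Bool.not_eq_true] at h
    have h' : (((ones f).filter fun z => z i = true).card : ℝ) +
        ((ones f).filter fun z => z i = false).card = (ones f).card := by exact_mod_cast h
    linarith
  let c : Cube n → ℝ := fun z => (if z i = true then 1 else 0) - μ
  have hc : avg f c = 0 := by
    simp only [c, sub_eq_add_neg]
    rw [avg_add, avg_const hf]
    exact add_neg_cancel μ
  have hc2 : (avg f fun z => c z ^ 2) ≤ 1 / 4 := by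
    have : ∀ z, c z ^ 2 = (1 - 2 * μ) * (if z i = true then 1 else 0) + μ ^ 2 := fun z => by
      simp only [c]; split_ifs <;> ring
    simp only [this]
    rw [avg_add, avg_const_mul, avg_const hf, ← hμ]
    nlinarith [sq_nonneg (μ - 1 / 2)]
  have key : (expect f (samples m) fun S => if i ∈ badCoords f (biasVector S) then 1 else 0) ≤
      expect f (samples m) fun S => 400 / (9 * m ^ 2) * (S.map c).sum ^ 2 := by
    refine expect_mono ((always_samples m).mono fun S hS => ?_)
    have hsum : (S.map c).sum = (S.countP fun z => z i) - m * μ := by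
      rw [← hS.1]; exact sum_map_sub_const S i μ
    split_ifs with hb
    · obtain ⟨b, hd, hb⟩ := (mem_filter.1 hb).2
      have h2 : 9 * (m : ℝ) ^ 2 / 400 ≤ (S.map c).sum ^ 2 := by
        have e : 9 * (m : ℝ) ^ 2 / 400 = (3 * m / 20) ^ 2 := by ring
        rw [e]
        have hb' : 5 * (((ones f).filter fun z => z i = b).card : ℝ) < 3 * (ones f).card := by
          exact_mod_cast hb
        rw [biasVector] at hd
        split_ifs at hd with h3 h4
        · obtain rfl : false = b := by simpa using hd
          rw [h0] at hb'
          have h5 : 2 / 5 ≤ μ := by nlinarith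
          have h3' : 4 * ((S.countP fun z => z i : ℕ) : ℝ) < m := by
            rw [← hS.1]; exact_mod_cast h3
          rw [← neg_sq (S.map c).sum, hsum]
          refine pow_le_pow_left₀ (by positivity) ?_ 2
          nlinarith
        · obtain rfl : true = b := by simpa using hd
          rw [h1] at hb'
          have h5 : μ ≤ 3 / 5 := by nlinarith
          have h4' : 3 * (m : ℝ) < 4 * ((S.countP fun z => z i : ℕ) : ℝ) := by
            rw [← hS.1]; exact_mod_cast h4
          rw [hsum]
          refine pow_le_pow_left₀ (by positivity) ?_ 2
          nlinarith
      calc (1 : ℝ) = 400 / (9 * m ^ 2) * (9 * (m : ℝ) ^ 2 / 400) := by field_simp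
        _ ≤ _ := by gcongr
    · positivity
  refine key.trans ?_
  rw [expect_const_mul, (expect_samples_sq hf c hc m).2]
  calc 400 / (9 * (m : ℝ) ^ 2) * (m * avg f fun z => c z ^ 2) ≤ 400 / (9 * (m : ℝ) ^ 2) * (m * (1 / 4)) := by
        gcongr
    _ = 100 / (9 * (m : ℝ)) := by field_simp; norm_num
    _ ≤ 1 / 36 := by rw [div_le_div_iff₀ (by positivity) (by norm_num)]; linarith

/-- If a quantity depending on the samples is small whenever the badly estimated coordinates have
little weight, then its expectation is small. -/
theorem expect_samples_le_of_bad (hf : (ones f).Nonempty) {m : ℕ} (hm : 400 ≤ m) {w : Fin n → ℝ}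
    (hw0 : ∀ i, 0 ≤ w i) (hW : 0 < ∑ i, w i) {v : List (Cube n) → ℝ} (hv1 : ∀ S, v S ≤ 1)
    (hv : ∀ S, S.length = m → ∑ i ∈ badCoords f (biasVector S), w i ≤ (∑ i, w i) / 4 →
      v S ≤ 1 / 10) : expect f (samples m) v ≤ 1 / 3 := by
  set W := ∑ i, w i
  have h1 : expect f (samples m) v ≤ expect f (samples m) fun S =>
      1 / 10 + 4 / W * ∑ i, w i * if i ∈ badCoords f (biasVector S) then 1 else 0 := by
    refine expect_mono ((always_samples m).mono fun S hS => ?_)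
    have e : ∑ i, w i * (if i ∈ badCoords f (biasVector S) then (1 : ℝ) else 0) =
        ∑ i ∈ badCoords f (biasVector S), w i := by simp
    rw [e]
    have h0 : 0 ≤ ∑ i ∈ badCoords f (biasVector S), w i := sum_nonneg fun i _ => hw0 i
    by_cases hb : ∑ i ∈ badCoords f (biasVector S), w i ≤ W / 4
    · have := hv S hS.1 hb
      have : 0 ≤ 4 / W * ∑ i ∈ badCoords f (biasVector S), w i := by positivity
      linarith
    · have : 4 / W * (W / 4) ≤ 4 / W * ∑ i ∈ badCoords f (biasVector S), w i := by
        gcongr; exact (not_le.1 hb).le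
      have h2 : 4 / W * (W / 4) = 1 := by field_simp
      linarith [hv1 S]
  refine h1.trans ?_
  rw [expect_add, expect_const hf, expect_const_mul, expect_sum _ hf]
  have h2 : ∑ i, expect f (samples m) (fun S => w i * if i ∈ badCoords f (biasVector S) then 1 else 0)
      ≤ W * (1 / 36) := by
    rw [sum_mul]
    refine sum_le_sum fun i _ => ?_
    rw [expect_const_mul]
    exact mul_le_mul_of_nonneg_left (expect_mem_badCoords_le hf i hm) (hw0 i)
  calc _ ≤ 1 / 10 + 4 / W * (W * (1 / 36)) := by gcongr
    _ = 1 / 10 + 1 / 9 := by field_simp; norm_num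
    _ ≤ 1 / 3 := by norm_num

theorem sum_countP_ne_le {B : ℝ} {a : Cube n} {S : List (Cube n)}
    (hS : ∀ x ∈ S, (hammingDist x a : ℝ) ≤ B) :
    ∑ i, ((S.countP fun x => x i != a i : ℕ) : ℝ) ≤ S.length * B := by
  induction S with
  | nil => simp
  | cons x S ih =>
    have h1 := ih fun y hy => hS y (by simp [hy])
    have h2 := hS x (by simp)
    have h3 : ∑ i, ((List.countP (fun x => x i != a i) (x :: S) : ℕ) : ℝ) =
        ∑ i, ((S.countP fun x => x i != a i : ℕ) : ℝ) + hammingDist x a := by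
      simp only [List.countP_cons, Nat.cast_add, sum_add_distrib, hammingDist, bne_iff_ne,
        card_filter, Nat.cast_sum]
    rw [h3, List.length_cons]; push_cast; linarith

theorem countP_ne (a : Cube n) (S : List (Cube n)) (i : Fin n) :
    (S.countP fun x => x i != a i) = if a i then S.length - S.countP fun z => z i
      else S.countP fun z => z i := by
  cases h : a i
  · simp
  · have := List.length_eq_countP_add_countP (fun z : Cube n => z i) (l := S)
    simp only [Bool.bne_true, if_true]
    simp only [Bool.not_eq_true, Bool.decide_eq_false] at this
    omega

theorem card_mul_le_of_countP {B q : ℝ} {a : Cube n} {S : List (Cube n)} (hS0 : 0 < S.length)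
    (hS : ∀ x ∈ S, (hammingDist x a : ℝ) ≤ B) (s : Finset (Fin n))
    (hs : ∀ i ∈ s, q * S.length ≤ ((S.countP fun x => x i != a i : ℕ) : ℝ)) :
    q * s.card ≤ B := by
  have h0 : (0 : ℝ) < S.length := by exact_mod_cast hS0
  have h1 : s.card * (q * S.length) ≤ S.length * B :=
    calc s.card * (q * S.length) = ∑ i ∈ s, q * S.length := by simp
      _ ≤ ∑ i ∈ s, ((S.countP fun x => x i != a i : ℕ) : ℝ) := sum_le_sum hs
      _ ≤ ∑ i, ((S.countP fun x => x i != a i : ℕ) : ℝ) :=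
        sum_le_univ_sum_of_nonneg fun i => Nat.cast_nonneg _
      _ ≤ _ := sum_countP_ne_le hS
  nlinarith

theorem card_diffSet_biasVector_le {B : ℝ} {a : Cube n} {S : List (Cube n)} (hS0 : 0 < S.length)
    (hS : ∀ x ∈ S, (hammingDist x a : ℝ) ≤ B) :
    3 / 4 * ((diffSet a (biasVector S)).card : ℝ) ≤ B := by
  refine card_mul_le_of_countP hS0 hS _ fun i hi => ?_
  rw [mem_diffSet, biasVector] at hi
  have h1 : (S.countP fun z => z i) ≤ S.length := List.countP_le_length
  have h2 : 3 * S.length ≤ 4 * S.countP fun x => x i != a i := by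
    rw [countP_ne]
    split_ifs at hi <;> cases h : a i <;> (simp_all; try omega)
  have h3 : 3 * (S.length : ℝ) ≤ 4 * ((S.countP fun x => x i != a i : ℕ) : ℝ) := by exact_mod_cast h2
  linarith

theorem card_unfixedCoords_biasVector_le {B : ℝ} {a : Cube n} {S : List (Cube n)}
    (hS0 : 0 < S.length) (hS : ∀ x ∈ S, (hammingDist x a : ℝ) ≤ B) :
    1 / 4 * ((unfixedCoords (biasVector S)).card : ℝ) ≤ B := by
  refine card_mul_le_of_countP hS0 hS _ fun i hi => ?_
  rw [unfixedCoords, mem_filter, biasVector] at hi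
  have h1 : (S.countP fun z => z i) ≤ S.length := List.countP_le_length
  have h2 : S.length ≤ 4 * S.countP fun x => x i != a i := by
    rw [countP_ne]
    split_ifs at hi <;> cases h : a i <;> (simp_all; try omega)
  have h3 : (S.length : ℝ) ≤ 4 * ((S.countP fun x => x i != a i : ℕ) : ℝ) := by exact_mod_cast h2
  linarith

theorem two_le_card_ones (hf : (ones f).Nonempty) {ε : ℝ} (hε : 0 < ε)
    (hfar : ε ≤ reldistTo f {g | Unate g}) : 2 ≤ (ones f).card := by
  by_contra h
  have hN : (0 : ℝ) < (ones f).card := by exact_mod_cast hf.card_pos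
  have h1 : (ones f).card ≤ 1 := by omega
  have hu : Unate f := by
    intro i
    rw [monotoneInDir_iff, monotoneInDir_iff]
    by_contra! h2
    obtain ⟨⟨z, hz⟩, ⟨w, hw⟩⟩ := h2
    rw [mem_boundary] at hz hw
    have := card_le_one.1 h1 z (mem_ones.2 hz.1) w (mem_ones.2 hw.1)
    rw [this, hw.2.1] at hz
    simp at hz
  have h2 := le_card_symmDiff hf hfar hu
  simp only [symmDiff_self, bot_eq_empty, card_empty, Nat.cast_zero] at h2
  nlinarith

theorem one_le_logb {N : ℕ} (hN : 2 ≤ N) : 1 ≤ Real.logb 2 N := by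
  rw [Real.le_logb_iff_rpow_le (by norm_num) (by positivity)]
  simpa using (by exact_mod_cast hN : (2 : ℝ) ≤ N)

open Classical in
/-- The common part of the soundness proofs: after a sample `a`, samples `S` used for the estimated
bias and samples `T`, all of which have to be close to `a`, a value `Q S` is returned. -/
theorem expect_phases_le (hf : (ones f).Nonempty) {ε : ℝ} (hε : 0 < ε)
    (hfar : ε ≤ reldistTo f {g | Unate g}) (a : Cube n) {Q : List (Cube n) → ℝ}
    (hQ1 : ∀ S, Q S ≤ 1)
    (hQ : ∀ (S : List (Cube n)) (R : ℕ) (w : Fin n → ℝ), 0 < S.length →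
      (∀ x ∈ S, (hammingDist x a : ℝ) ≤ 2 * Real.logb 2 (ones f).card) →
      (R : ℝ) ≤ 4 * Real.logb 2 (ones f).card →
      (∀ i b, w i ≤ ((nearBoundary f a R i b).card : ℝ) / (ones f).card) →
      (ε / 16 ≤ ∑ i ∈ goodCoords f (biasVector S), w i ∨
        ε / 8 ≤ ∑ i ∈ unfixedCoords (biasVector S), w i) → Q S ≤ 1 / 10) :
    (expect f (samples ⌈400 * Real.logb 2 (ones f).card⌉₊) fun S =>
      expect f (samples ⌈30 / ε⌉₊) fun T =>
        if (∀ x ∈ S, (hammingDist x a : ℝ) ≤ 2 * Real.logb 2 (ones f).card) ∧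
          ∀ x ∈ T, (hammingDist x a : ℝ) ≤ 2 * Real.logb 2 (ones f).card then Q S else 0) ≤ 1 / 3 := by
  have hN : (0 : ℝ) < (ones f).card := by exact_mod_cast hf.card_pos
  have hl := one_le_logb (two_le_card_ones hf hε hfar)
  set l := Real.logb 2 (ones f).card with hl_def
  set K := ⌊2 * l⌋₊ with hK
  have hKl : (K : ℝ) ≤ 2 * l := Nat.floor_le (by linarith)
  have hK0 : 0 < K := Nat.floor_pos.2 (by linarith)
  have hnear : ∀ x, (hammingDist x a : ℝ) ≤ 2 * l ↔ hammingDist x a ≤ K := fun x =>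
    (Nat.le_floor_iff (by linarith)).symm
  have hcount : (((ones f).filter fun z => hammingDist z a ≤ K).card : ℝ) +
      ((ones f).filter fun z => K < hammingDist z a).card = (ones f).card := by
    have := card_filter_add_card_filter_not (s := ones f) fun z => hammingDist z a ≤ K
    simp only [not_le] at this
    exact_mod_cast this
  by_cases hs : (((ones f).filter fun z => K < hammingDist z a).card : ℝ) ≤ ε / 10 * (ones f).card
  · obtain ⟨R, hR, hW⟩ := exists_radius hf a hK0 hfar hs
    let w : Fin n → ℝ := fun i =>
      min ((nearBoundary f a R i false).card : ℝ) (nearBoundary f a R i true).card / (ones f).card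
    have hw : ∀ i b, w i ≤ ((nearBoundary f a R i b).card : ℝ) / (ones f).card := by
      intro i b
      refine div_le_div_of_nonneg_right ?_ hN.le
      cases b
      · exact min_le_left _ _
      · exact min_le_right _ _
    have hw0 : ∀ i, 0 ≤ w i := fun i => by positivity
    have hW' : ε / 4 ≤ ∑ i, w i := by
      rw [← sum_div, le_div_iff₀ hN]; exact hW
    have hm : 400 ≤ ⌈400 * l⌉₊ := by
      have : (400 : ℝ) ≤ ⌈400 * l⌉₊ := (by linarith : (400 : ℝ) ≤ 400 * l).trans (Nat.le_ceil _)
      exact_mod_cast this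
    refine expect_samples_le_of_bad hf hm hw0 (by linarith) (fun S => ?_) fun S hS hb => ?_
    · refine expect_le_const hf (always_of_forall _ fun T => ?_)
      split_ifs
      · exact hQ1 S
      · norm_num
    · refine expect_le_const hf (always_of_forall _ fun T => ?_)
      split_ifs with hST
      · refine hQ S R w (by omega) hST.1 ?_ hw ?_
        · have : (R : ℝ) ≤ 2 * K := by exact_mod_cast hR
          linarith
        · have := sum_goodCoords_add f (biasVector S) w
          by_contra! h
          linarith
      · norm_num
  · refine expect_le_const hf (always_of_forall _ fun S => ?_)
    have h1 : (avg f fun z => if hammingDist z a ≤ K then 1 else 0) ≤ 1 - ε / 10 := by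
      rw [avg_indicator, div_le_iff₀ hN]
      linarith
    calc _ ≤ expect f (samples ⌈30 / ε⌉₊) fun T => if ∀ x ∈ T, hammingDist x a ≤ K then 1 else 0 := by
          refine expect_mono (always_of_forall _ fun T => ?_)
          simp only [hnear]
          split_ifs with h2 h3 h3
          · exact hQ1 S
          · exact absurd h2.2 h3
          · norm_num
          · norm_num
      _ = _ := expect_samples_forall hf (fun x => hammingDist x a ≤ K) _
      _ ≤ Real.exp (-(ε / 10 * ⌈30 / ε⌉₊)) :=
          pow_le_exp_neg (avg_nonneg fun z _ => by split_ifs <;> norm_num) h1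
      _ ≤ 1 / 3 := by
          refine exp_neg_le_one_div (by norm_num) ?_
          calc (3 - 1 : ℝ) ≤ ε / 10 * (30 / ε) := by field_simp; norm_num
            _ ≤ _ := by gcongr; exact Nat.le_ceil _

theorem nearBoundary_subset (a : Cube n) (R : ℕ) (i : Fin n) (b : Bool) :
    nearBoundary f a R i b ⊆ boundary f i b := filter_subset _ _

theorem le_card_boundary_div {a : Cube n} {R : ℕ} {w : Fin n → ℝ}
    (hw : ∀ i b, w i ≤ ((nearBoundary f a R i b).card : ℝ) / (ones f).card) (i : Fin n) (b : Bool) :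
    w i ≤ ((boundary f i b).card : ℝ) / (ones f).card :=
  (hw i b).trans (div_le_div_of_nonneg_right
    (by exact_mod_cast card_le_card (nearBoundary_subset a R i b)) (Nat.cast_nonneg _))

theorem acc_biasedTest {M ε' : ℝ} {d : PString n} (h : fixedCoords d ≠ ∅) :
    acc f (biasedTest M ε' d) = acc f (biasedStep d) ^ (10 * ⌈M / ε'⌉₊) := by
  rw [biasedTest, if_neg h, acc_runAll, List.map_replicate, List.prod_replicate]

theorem acc_unbiasedTest {ε' : ℝ} {d : PString n} (h : (unfixedCoords d).Nonempty) :
    acc f (unbiasedTest ε' d) =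
      ∏ j ∈ range (⌈Real.logb 2 ((unfixedCoords d).card / ε')⌉₊ + 2),
        acc f (unbiasedStep d h (j + 1)) ^ ⌈50 * (unfixedCoords d).card / (ε' * 2 ^ (j + 1))⌉₊ := by
  rw [unbiasedTest, dif_pos h, acc_runAll, List.map_map, prod_map_range]
  refine prod_congr rfl fun j _ => ?_
  simp only [Function.comp_apply, acc_runAll, List.map_replicate, List.prod_replicate]

theorem unfixedCoords_nonempty_of_sum_pos {d : PString n} {w : Fin n → ℝ}
    (h : 0 < ∑ i ∈ unfixedCoords d, w i) : (unfixedCoords d).Nonempty := by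
  by_contra h'
  rw [not_nonempty_iff_eq_empty.1 h', sum_empty] at h
  exact h.false

theorem acc_unatenessTesterKnownN_le (hf : (ones f).Nonempty) {ε : ℝ} (hε : 0 < ε)
    (hfar : ε ≤ reldistTo f {g | Unate g}) :
    acc f (unatenessTesterKnownN n (ones f).card ε) ≤ 1 / 3 := by
  classical
  have hl := one_le_logb (two_le_card_ones hf hε hfar)
  rw [unatenessTesterKnownN, acc_bind, expect_sample]
  refine avg_le_const hf fun a ha => ?_
  let M : List (Cube n) → ℝ := fun S =>
    2 * Real.logb 2 (ones f).card + (diffSet a (biasVector S)).card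
  refine Eq.trans_le ?_ (expect_phases_le hf hε hfar a (Q := fun S =>
    acc f (biasedTest (M S) (ε / 64) (biasVector S)) * acc f (unbiasedTest (ε / 64) (biasVector S)))
    (fun S => mul_le_one₀ (acc_le_one hf _) (acc_nonneg hf _) (acc_le_one hf _)) ?_)
  · rw [acc_bind]
    congr 1; funext S
    have e : ∀ T : List (Cube n), (∃ x ∈ T, 2 * Real.logb 2 (ones f).card < (hammingDist x a : ℝ)) ↔
        ¬ ∀ x ∈ T, (hammingDist x a : ℝ) ≤ 2 * Real.logb 2 (ones f).card := fun T => by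
      push Not; rfl
    simp only [e]
    by_cases hS : ∀ x ∈ S, (hammingDist x a : ℝ) ≤ 2 * Real.logb 2 (ones f).card
    · rw [if_neg (not_not.2 hS), acc_bind]
      congr 1; funext T
      by_cases hT : ∀ x ∈ T, (hammingDist x a : ℝ) ≤ 2 * Real.logb 2 (ones f).card
      · rw [if_neg (not_not.2 hT), if_pos ⟨hS, hT⟩, acc_runAll]
        simp [M]
      · rw [if_pos hT, if_neg fun h => hT h.2, acc_false]
    · rw [if_pos hS, acc_false]
      simp only [hS, false_and, if_false, expect_const hf]
  · intro S R w hS0 hS hR hw hsum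
    rcases hsum with hsum | hsum
    · refine (mul_le_of_le_one_right (acc_nonneg hf _) (acc_le_one hf _)).trans ?_
      have hM : 0 < M S := by positivity
      have hne : fixedCoords (biasVector S) ≠ ∅ := by
        intro h
        have h2 : goodCoords f (biasVector S) ⊆ fixedCoords (biasVector S) := fun i hi => by
          obtain ⟨b, hb, -⟩ := (mem_filter.1 hi).2
          simp [fixedCoords, hb]
        have h3 : goodCoords f (biasVector S) = ∅ := subset_empty.1 (h ▸ h2)
        rw [h3, sum_empty] at hsum
        linarith
      rw [acc_biasedTest hne]
      refine pow_biasedStep_le hε hM (acc_nonneg hf _)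
        (acc_biasedStep_le hf (by positivity) (fun z hz => ?_) hw) hsum
      have h1 : ((diffSet z (biasVector S)).card : ℝ) ≤
          hammingDist z a + (diffSet a (biasVector S)).card := by
        exact_mod_cast card_diffSet_le z a (biasVector S)
      have h2 : (hammingDist z a : ℝ) ≤ R := by exact_mod_cast hz
      have h3 : (0 : ℝ) ≤ (diffSet a (biasVector S)).card := Nat.cast_nonneg _
      simp only [M]
      linarith
    · refine (mul_le_of_le_one_left (acc_nonneg hf _) (acc_le_one hf _)).trans ?_
      have hne := unfixedCoords_nonempty_of_sum_pos ((by positivity : 0 < ε / 8).trans_le hsum)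
      rw [acc_unbiasedTest hne]
      exact prod_unbiasedStep_le hf hne (le_card_boundary_div hw) (by positivity) le_rfl
        (by linarith)

theorem acc_parTester_le (hf : (ones f).Nonempty) {ε : ℝ} (hε : 0 < ε)
    (hfar : ε ≤ reldistTo f {g | Unate g}) :
    acc f (parTester n (ones f).card ε) ≤ 1 / 3 := by
  classical
  have hN := two_le_card_ones hf hε hfar
  have hl := one_le_logb hN
  rw [parTester, if_neg (by omega), acc_bind, expect_sample]
  refine avg_le_const hf fun a ha => ?_
  set l := Real.logb 2 (ones f).card with hl_def
  let Qb : PString n → ℝ := fun d => acc f (parBiasedStep 25 d) ^ (10 * ⌈5 * l / (ε / 64)⌉₊)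
  let Qu : PString n → ℝ := fun d => ∏ j ∈ range (⌈Real.logb 2 (8 * l / (ε / 64))⌉₊ + 2),
    acc f (parUnbiasedStep d (j + 1)) ^ ⌈50 * (8 * l) / (ε / 64 * 2 ^ (j + 1))⌉₊
  have hQ : ∀ d, ((parSteps l (ε / 64) d).map (acc f)).prod = Qb d * Qu d := by
    intro d
    rw [parSteps, List.map_append, List.prod_append, List.map_replicate, List.prod_replicate,
      List.map_flatten, List.prod_flatten, List.map_map, List.map_map, prod_map_range]
    simp only [Qb, Qu, Function.comp_apply, List.map_replicate, List.prod_replicate]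
  have hb0 : ∀ d, 0 ≤ Qb d := fun d => pow_nonneg (acc_nonneg hf _) _
  have hb1 : ∀ d, Qb d ≤ 1 := fun d => pow_le_one₀ (acc_nonneg hf _) (acc_le_one hf _)
  have hu0 : ∀ d, 0 ≤ Qu d := fun d => prod_nonneg fun j _ => pow_nonneg (acc_nonneg hf _) _
  have hu1 : ∀ d, Qu d ≤ 1 := fun d => prod_le_one (fun j _ => pow_nonneg (acc_nonneg hf _) _)
    fun j _ => pow_le_one₀ (acc_nonneg hf _) (acc_le_one hf _)
  refine Eq.trans_le ?_ (expect_phases_le hf hε hfar a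
    (Q := fun S => Qb (biasVector S) * Qu (biasVector S))
    (fun S => mul_le_one₀ (hb1 _) (hu0 _) (hu1 _)) ?_)
  · rw [acc_bind]
    congr 1; funext S
    rw [acc_bind]
    congr 1; funext T
    rw [acc_conj, hQ]
    simp only [decide_eq_true_eq, List.forall_mem_append]
    split_ifs <;> simp
  · intro S R w hS0 hS hR hw hsum
    have hd := card_diffSet_biasVector_le hS0 hS
    have hU := card_unfixedCoords_biasVector_le hS0 hS
    rcases hsum with hsum | hsum
    · refine (mul_le_of_le_one_right (hb0 _) (hu1 _)).trans ?_
      refine pow_biasedStep_le hε (by positivity) (acc_nonneg hf _)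
        (acc_parBiasedStep_le hf le_rfl (by positivity) (fun z hz => ?_) hw) hsum
      have h1 : ((diffSet z (biasVector S)).card : ℝ) ≤
          hammingDist z a + (diffSet a (biasVector S)).card := by
        exact_mod_cast card_diffSet_le z a (biasVector S)
      have h2 : (hammingDist z a : ℝ) ≤ R := by exact_mod_cast hz
      linarith
    · refine (mul_le_of_le_one_left (hu0 _) (hb1 _)).trans ?_
      have hne := unfixedCoords_nonempty_of_sum_pos ((by positivity : 0 < ε / 8).trans_le hsum)
      simp only [Qu, parUnbiasedStep, dif_pos hne]
      exact prod_unbiasedStep_le hf hne (le_card_boundary_div hw) (by positivity) (by linarith)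
        (by linarith)

end RelUnate

namespace RelUnate

open OracleProg Finset

/-! ### Non-adaptive implementations -/

namespace OracleProg

variable {n : ℕ} {α β γ : Type}

theorem bind_bind (p : OracleProg n α) (g : α → OracleProg n β) (h : β → OracleProg n γ) :
    (p >>= g) >>= h = p >>= fun a => g a >>= h := by
  change (p.andThen g).andThen h = p.andThen fun a => (g a).andThen h
  induction p with
  | done a => rfl
  | samp k ih => simp only [andThen, ih]
  | query x k ih => simp only [andThen, ih]
  | toss m k ih => simp only [andThen, ih]

theorem run_bind (f : Cube n → Bool) (hf : (ones f).Nonempty) (p : OracleProg n α)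
    (g : α → OracleProg n β) :
    run f hf (p >>= g) = (run f hf p).bind fun a => run f hf (g a) := by
  change run f hf (p.andThen g) = _
  induction p with
  | done a => simp [andThen, run]
  | samp k ih => simp only [andThen, run, ih, PMF.bind_bind]
  | query x k ih => simp only [andThen, run, ih]
  | toss m k ih => simp only [andThen, run, ih, PMF.bind_bind]

theorem askAll_bind (f : Cube n → Bool) (hf : (ones f).Nonempty) (xs : List (Cube n))
    (g : List Bool → OracleProg n β) :
    run f hf (askAll xs >>= g) = run f hf (g (xs.map f)) := by
  induction xs generalizing g with
  | nil => rfl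
  | cons x xs ih =>
    rw [askAll, bind_bind]
    change run f hf ((askAll xs >>= fun vs => pure (f x :: vs)) >>= g) = _
    rw [bind_bind, ih]
    rfl

theorem maxCalls_round (f : Cube n → Bool) (xs : List (Cube n)) (g : List Bool → α) :
    maxCalls f (askAll xs >>= fun vs => pure (g vs)) = xs.length := by
  induction xs generalizing g with
  | nil => rfl
  | cons x xs ih =>
    rw [askAll, bind_bind]
    change 1 + maxCalls f ((askAll xs >>= fun vs => pure (f x :: vs)) >>= fun vs => pure (g vs)) = _
    rw [bind_bind, List.length_cons, add_comm, ← ih fun vs => g (f x :: vs)]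
    rfl

/-- `p` has the same output distribution as a non-adaptive program with `m` samples that makes at
most `B` calls. -/
def HasNonAdaptive (m B : ℕ) (p : OracleProg n α) : Prop :=
  ∃ r : OracleProg n α, NonAdaptive m r ∧ (∀ f hf, run f hf r = run f hf p) ∧
    ∀ f, maxCalls f r ≤ B

theorem hasNonAdaptive_round (xs : List (Cube n)) (g : List Bool → α) :
    HasNonAdaptive 0 xs.length (askAll xs >>= fun vs => pure (g vs)) :=
  ⟨_, NonAdaptive.round xs g, fun _ _ => rfl, fun f =>
    (maxCalls_round f xs g).le⟩

theorem hasNonAdaptive_pure (a : α) : HasNonAdaptive 0 0 (pure a : OracleProg n α) :=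
  hasNonAdaptive_round [] fun _ => a

theorem HasNonAdaptive.samp {m B : ℕ} {k : Cube n → OracleProg n α}
    (h : ∀ z, HasNonAdaptive m B (k z)) : HasNonAdaptive (m + 1) (1 + B) (OracleProg.samp k) := by
  choose r h1 h2 h3 using h
  refine ⟨OracleProg.samp r, NonAdaptive.samp r h1, fun f hf => ?_, fun f => ?_⟩
  · simp only [run, h2]
  · simp only [maxCalls, add_le_add_iff_left]
    exact Finset.sup_le fun z _ => h3 z f

theorem HasNonAdaptive.toss {m B s : ℕ} {k : Fin (s + 1) → OracleProg n α}
    (h : ∀ z, HasNonAdaptive m B (k z)) : HasNonAdaptive m B (OracleProg.toss s k) := by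
  choose r h1 h2 h3 using h
  refine ⟨OracleProg.toss s r, NonAdaptive.toss s r h1, fun f hf => ?_, fun f => ?_⟩
  · simp only [run, h2]
  · exact Finset.sup_le fun z _ => h3 z f

theorem HasNonAdaptive.sample_bind {m B : ℕ} {k : Cube n → OracleProg n α}
    (h : ∀ z, HasNonAdaptive m B (k z)) : HasNonAdaptive (m + 1) (1 + B) (sample >>= k) :=
  HasNonAdaptive.samp h

theorem HasNonAdaptive.uniformFrom_bind {m B : ℕ} {s : Finset (Fin n)} (hs : s.Nonempty)
    {k : Fin n → OracleProg n α} (h : ∀ i, HasNonAdaptive m B (k i)) :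
    HasNonAdaptive m B (uniformFrom s hs >>= k) :=
  HasNonAdaptive.toss fun _ => h _

theorem HasNonAdaptive.samples_bind {m B t : ℕ} {k : List (Cube n) → OracleProg n α}
    (h : ∀ S : List (Cube n), S.length = t → HasNonAdaptive m B (k S)) :
    HasNonAdaptive (m + t) (t + B) (samples t >>= k) := by
  induction t generalizing k with
  | zero => rw [Nat.zero_add]; exact h [] rfl
  | succ t ih =>
    rw [samples, bind_bind, show t + 1 + B = 1 + (t + B) by omega]
    refine HasNonAdaptive.sample_bind (m := m + t) fun z => ?_
    rw [bind_bind]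
    exact ih fun S hS => h (z :: S) (by simp [hS])

theorem NonAdaptive.combine {m m' : ℕ} {p : OracleProg n α} {q : OracleProg n β} (g : α → β → γ)
    (hp : NonAdaptive m p) (hq : NonAdaptive m' q) :
    ∃ r : OracleProg n γ, NonAdaptive (m + m') r ∧
      (∀ f hf, run f hf r = run f hf (p >>= fun x => q >>= fun y => pure (g x y))) ∧
      ∀ f, maxCalls f r ≤ maxCalls f p + maxCalls f q := by
  induction hp with
  | samp k h ih =>
    choose r h1 h2 h3 using ih
    refine ⟨OracleProg.samp r, ?_, fun f hf => ?_, fun f => ?_⟩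
    · rw [Nat.add_right_comm]; exact NonAdaptive.samp r h1
    · simp only [run, h2, run_bind, PMF.bind_bind]
    · simp only [maxCalls, add_assoc, add_le_add_iff_left]
      exact Finset.sup_le fun z hz => (h3 z f).trans
        (Nat.add_le_add_right (Finset.le_sup (f := fun z => maxCalls f (k z)) hz) _)
  | toss s k h ih =>
    choose r h1 h2 h3 using ih
    refine ⟨OracleProg.toss s r, NonAdaptive.toss s r h1, fun f hf => ?_, fun f => ?_⟩
    · simp only [run, h2, run_bind, PMF.bind_bind]
    · exact Finset.sup_le fun z hz => (h3 z f).trans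
        (Nat.add_le_add_right (Finset.le_sup (f := fun z => maxCalls f (k z)) hz) _)
  | round xs dec =>
    induction hq with
    | samp k h ih =>
      choose r h1 h2 h3 using ih
      refine ⟨OracleProg.samp r, NonAdaptive.samp r h1, fun f hf => ?_, fun f => ?_⟩
      · have e := fun z => h2 z f hf
        simp only [bind_bind, askAll_bind] at e
        simp only [bind_bind, askAll_bind, run, e]
        rfl
      · simp only [maxCalls, add_left_comm _ 1, add_le_add_iff_left]
        exact Finset.sup_le fun z hz => (h3 z f).trans
          (Nat.add_le_add_left (Finset.le_sup (f := fun z => maxCalls f (k z)) hz) _)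
    | toss s k h ih =>
      choose r h1 h2 h3 using ih
      refine ⟨OracleProg.toss s r, NonAdaptive.toss s r h1, fun f hf => ?_, fun f => ?_⟩
      · have e := fun z => h2 z f hf
        simp only [bind_bind, askAll_bind] at e
        simp only [bind_bind, askAll_bind, run, e]
        rfl
      · exact Finset.sup_le fun z hz => (h3 z f).trans
          (Nat.add_le_add_left (Finset.le_sup (f := fun z => maxCalls f (k z)) hz) _)
    | round ys dec' =>
      refine ⟨_, NonAdaptive.round (xs ++ ys)
        fun vs => g (dec (vs.take xs.length)) (dec' (vs.drop xs.length)), fun f hf => ?_,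
        fun f => ?_⟩
      · simp only [bind_bind, askAll_bind, List.map_append]
        change _ = run f hf (askAll ys >>= fun vs => pure (g (dec (xs.map f)) (dec' vs)))
        rw [askAll_bind, List.take_left' (by simp), List.drop_left' (by simp)]
      · rw [maxCalls_round, maxCalls_round, maxCalls_round, List.length_append]

theorem HasNonAdaptive.mono {m B B' : ℕ} {p : OracleProg n α} (h : HasNonAdaptive m B p)
    (hB : B ≤ B') : HasNonAdaptive m B' p := by
  obtain ⟨r, h1, h2, h3⟩ := h
  exact ⟨r, h1, h2, fun f => (h3 f).trans hB⟩

theorem HasNonAdaptive.combine {m m' B B' : ℕ} {p : OracleProg n α} {q : OracleProg n β}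
    (g : α → β → γ) (hp : HasNonAdaptive m B p) (hq : HasNonAdaptive m' B' q) :
    HasNonAdaptive (m + m') (B + B') (p >>= fun x => q >>= fun y => pure (g x y)) := by
  obtain ⟨p', h1, h2, h3⟩ := hp
  obtain ⟨q', h4, h5, h6⟩ := hq
  obtain ⟨r, h7, h8, h9⟩ := h1.combine g h4
  refine ⟨r, h7, fun f hf => ?_, fun f => (h9 f).trans (Nat.add_le_add (h3 f) (h6 f))⟩
  simp only [h8, run_bind, h2, h5]

end OracleProg

variable {n : ℕ}

theorem hasNonAdaptive_pairTest (i : Fin n) (S : List (Cube n)) :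
    HasNonAdaptive 0 S.length (pairTest i S) := by
  have h := hasNonAdaptive_round (S.map fun z => flipBit z i) fun vs =>
    if (∃ p ∈ S.zip vs, p.1 i = false ∧ p.2 = false) ∧
      (∃ q ∈ S.zip vs, q.1 i = true ∧ q.2 = false) then false else true
  rw [List.length_map] at h
  convert h using 1
  rw [pairTest]
  congr 1; funext vs
  split_ifs <;> rfl

theorem hasNonAdaptive_parBiasedStep (t : ℕ) (d : PString n) :
    HasNonAdaptive (0 + t + 1) (2 * (t + 1)) (parBiasedStep t d) := by
  rw [show 2 * (t + 1) = 1 + (t + (t + 1)) by omega]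
  refine HasNonAdaptive.sample_bind fun z => ?_
  refine HasNonAdaptive.samples_bind fun S hS => ?_
  split_ifs with h
  · refine HasNonAdaptive.uniformFrom_bind h fun i => ?_
    exact (hasNonAdaptive_pairTest i (z :: S)).mono (by simp [hS])
  · exact (hasNonAdaptive_pure true).mono (Nat.zero_le _)

theorem hasNonAdaptive_parUnbiasedStep (d : PString n) (r : ℕ) :
    HasNonAdaptive (0 + 3 * 2 ^ r) (3 * 2 ^ r + 3 * 2 ^ r) (parUnbiasedStep d r) := by
  rw [parUnbiasedStep]
  split_ifs with h
  · rw [unbiasedStep_eq]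
    refine HasNonAdaptive.uniformFrom_bind h fun i => HasNonAdaptive.samples_bind fun S hS => ?_
    exact hS ▸ hasNonAdaptive_pairTest i S
  · exact HasNonAdaptive.samples_bind fun S _ => (hasNonAdaptive_pure true).mono (Nat.zero_le _)

theorem hasNonAdaptive_conj (b : Bool) {ps : List (OracleProg n Bool)} {ms : List (ℕ × ℕ)}
    (h : List.Forall₂ (fun p m => HasNonAdaptive m.1 m.2 p) ps ms) :
    HasNonAdaptive (ms.map Prod.fst).sum (ms.map Prod.snd).sum (conj b ps) := by
  induction h with
  | nil => exact hasNonAdaptive_pure b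
  | cons h _ ih => exact HasNonAdaptive.combine (fun x y => x && y) h ih

/-- The numbers of samples and calls of the tests run by the non-adaptive algorithm. -/
noncomputable def stepCosts (l ε' : ℝ) : List (ℕ × ℕ) :=
  List.replicate (10 * ⌈5 * l / ε'⌉₊) (0 + 25 + 1, 2 * (25 + 1)) ++
    ((List.range (⌈Real.logb 2 (8 * l / ε')⌉₊ + 2)).map fun j =>
      List.replicate ⌈50 * (8 * l) / (ε' * 2 ^ (j + 1))⌉₊
        (0 + 3 * 2 ^ (j + 1), 3 * 2 ^ (j + 1) + 3 * 2 ^ (j + 1))).flatten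

theorem forall₂_replicate {α β : Type} {R : α → β → Prop} {a : α} {b : β} (h : R a b) (k : ℕ) :
    List.Forall₂ R (List.replicate k a) (List.replicate k b) := by
  induction k with
  | zero => exact List.Forall₂.nil
  | succ k ih => exact List.Forall₂.cons h ih

theorem forall₂_flatten_map {α β ι : Type} {R : α → β → Prop} {F : ι → List α} {G : ι → List β}
    (h : ∀ j, List.Forall₂ R (F j) (G j)) (l : List ι) :
    List.Forall₂ R (l.map F).flatten (l.map G).flatten := by
  induction l with
  | nil => exact List.Forall₂.nil
  | cons j l ih => exact List.rel_append (h j) ih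

theorem forall₂_parSteps (l ε' : ℝ) (d : PString n) :
    List.Forall₂ (fun p m => HasNonAdaptive m.1 m.2 p) (parSteps l ε' d) (stepCosts l ε') :=
  List.rel_append
    (forall₂_replicate (b := (0 + 25 + 1, 2 * (25 + 1))) (hasNonAdaptive_parBiasedStep 25 d) _)
    (forall₂_flatten_map (fun j => forall₂_replicate
      (b := (0 + 3 * 2 ^ (j + 1), 3 * 2 ^ (j + 1) + 3 * 2 ^ (j + 1)))
      (hasNonAdaptive_parUnbiasedStep d (j + 1)) _) _)

/-- The number of calls of the non-adaptive algorithm; `l` stands for `log N`. -/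
noncomputable def totalCalls (l ε : ℝ) : ℕ :=
  1 + (⌈400 * l⌉₊ + (⌈30 / ε⌉₊ + ((stepCosts l (ε / 64)).map Prod.snd).sum))

theorem hasNonAdaptive_parTester (n N : ℕ) (ε : ℝ) : ∃ m,
    HasNonAdaptive m (if N ≤ 1 then 0 else totalCalls (Real.logb 2 N) ε) (parTester n N ε) := by
  rw [parTester]
  split_ifs
  · exact ⟨0, hasNonAdaptive_pure true⟩
  · exact ⟨_, HasNonAdaptive.sample_bind fun a => HasNonAdaptive.samples_bind fun S _ =>
      HasNonAdaptive.samples_bind fun T _ => hasNonAdaptive_conj _ (forall₂_parSteps _ _ _)⟩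

/-! ### The number of calls -/

theorem sum_snd_stepCosts (l ε' : ℝ) : ((stepCosts l ε').map Prod.snd).sum =
    10 * ⌈5 * l / ε'⌉₊ * 52 + ∑ j ∈ range (⌈Real.logb 2 (8 * l / ε')⌉₊ + 2),
      ⌈50 * (8 * l) / (ε' * 2 ^ (j + 1))⌉₊ * (6 * 2 ^ (j + 1)) := by
  rw [stepCosts, List.map_append, List.sum_append, List.map_replicate, List.sum_replicate,
    List.map_flatten, List.sum_flatten, List.map_map, List.map_map, sum_map_range]
  simp only [Function.comp_apply, List.map_replicate, List.sum_replicate, smul_eq_mul]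
  congr 1
  refine sum_congr rfl fun j _ => ?_
  ring

theorem totalCalls_le {l ε : ℝ} (hl : 1 ≤ l) (hε : 0 < ε) (hε1 : ε ≤ 1) :
    (totalCalls l ε : ℝ) ≤ 3000000 * (l / ε) * Real.log (2 + l / ε) ^ 1 := by
  set X := l / ε with hX
  have hlX : l ≤ X := by rw [hX, le_div_iff₀ hε]; nlinarith
  have hX1 : 1 ≤ X := hl.trans hlX
  have hεX : 1 / ε ≤ X := by rw [hX]; gcongr
  have hlog : 1 ≤ Real.log (2 + X) := by
    rw [Real.le_log_iff_exp_le (by linarith)]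
    linarith [Real.exp_one_lt_d9]
  set L := ⌈Real.logb 2 (8 * l / (ε / 64))⌉₊ + 2 with hL
  have e0 : 8 * l / (ε / 64) = 512 * X := by rw [hX]; field_simp; norm_num
  have h512 : 0 ≤ Real.logb 2 (512 * X) := Real.logb_nonneg (by norm_num) (by linarith)
  have hceil : (⌈Real.logb 2 (512 * X)⌉₊ : ℝ) < Real.logb 2 (512 * X) + 1 := Nat.ceil_lt_add_one h512
  have hL2 : (2 : ℝ) ^ L ≤ 4096 * X := by
    rw [hL, e0, pow_add, ← Real.rpow_natCast]
    have h1 : (2 : ℝ) ^ (⌈Real.logb 2 (512 * X)⌉₊ : ℝ) ≤ 2 ^ (Real.logb 2 (512 * X) + 1) :=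
      Real.rpow_le_rpow_of_exponent_le (by norm_num) hceil.le
    rw [Real.rpow_add (by norm_num), Real.rpow_logb (by norm_num) (by norm_num) (by linarith),
      Real.rpow_one] at h1
    linarith
  have hL1 : (L : ℝ) ≤ 14 * Real.log (2 + X) := by
    have h1 : Real.logb 2 (512 * X) = 9 + Real.logb 2 X := by
      rw [Real.logb_mul (by norm_num) (by linarith), show (512 : ℝ) = 2 ^ (9 : ℕ) by norm_num,
        Real.logb_pow, Real.logb_self_eq_one (by norm_num)]
      norm_num
    have h2 : Real.logb 2 X ≤ 2 * Real.log (2 + X) := by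
      rw [Real.logb, div_le_iff₀ (Real.log_pos (by norm_num))]
      have h3 : Real.log X ≤ Real.log (2 + X) := Real.log_le_log (by linarith) (by linarith)
      nlinarith [Real.log_two_gt_d9]
    rw [hL, e0]; push_cast; linarith
  have ceil_le : ∀ x : ℝ, 0 ≤ x → (⌈x⌉₊ : ℝ) ≤ x + 1 := fun x hx => (Nat.ceil_lt_add_one hx).le
  have c1 := ceil_le (400 * l) (by linarith)
  have c2 := ceil_le (30 / ε) (by positivity)
  have c3 := ceil_le (5 * l / (ε / 64)) (by positivity)
  have e2 : 30 / ε = 30 * (1 / ε) := by ring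
  have e3 : 5 * l / (ε / 64) = 320 * X := by rw [hX]; field_simp; norm_num
  have c4 : ∑ j ∈ range L, (⌈50 * (8 * l) / (ε / 64 * 2 ^ (j + 1))⌉₊ : ℝ) * (6 * 2 ^ (j + 1)) ≤
      L * (153600 * X) + 12 * 2 ^ L := by
    have h1 : ∀ j, (⌈50 * (8 * l) / (ε / 64 * 2 ^ (j + 1))⌉₊ : ℝ) * (6 * 2 ^ (j + 1)) ≤
        153600 * X + 12 * 2 ^ j := by
      intro j
      calc _ ≤ (50 * (8 * l) / (ε / 64 * 2 ^ (j + 1)) + 1) * (6 * 2 ^ (j + 1)) := by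
            gcongr; exact ceil_le _ (by positivity)
        _ = _ := by rw [hX]; field_simp; ring
    refine (sum_le_sum fun j _ => h1 j).trans ?_
    rw [sum_add_distrib, ← mul_sum (f := fun j => (2 : ℝ) ^ j), geom_sum_eq (by norm_num)]
    simp only [sum_const, card_range, nsmul_eq_mul]
    linarith
  have c5 : L * (153600 * X) ≤ 14 * Real.log (2 + X) * (153600 * X) := by gcongr
  rw [totalCalls, sum_snd_stepCosts]
  push_cast
  rw [← hL]
  have h6 : X ≤ X * Real.log (2 + X) := le_mul_of_one_le_right (by linarith) hlog
  nlinarith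

variable {f : Cube n → Bool}

theorem maxCalls_confirmDirection (i : Fin n) (b : Bool) (t : ℕ) :
    maxCalls f (confirmDirection i b t) ≤ 2 * t := by
  induction t with
  | zero => exact le_rfl
  | succ t ih =>
    rw [confirmDirection, show 2 * (t + 1) = 1 + (1 + 2 * t) by omega]
    refine maxCalls_bind_le_of_forall maxCalls_sample fun z =>
      maxCalls_bind_le_of_forall (maxCalls_ask _) fun v => ?_
    split_ifs
    · exact Nat.zero_le _
    · exact ih

theorem maxCalls_biasedStep (d : PString n) : maxCalls f (biasedStep d) ≤ 52 := by
  rw [biasedStep]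
  refine maxCalls_bind_le_of_forall (A := 1) (B := 51) maxCalls_sample fun z => ?_
  split_ifs
  · refine maxCalls_bind_le_of_forall (A := 0) (B := 51) (maxCalls_uniformFrom _).le fun i => ?_
    refine maxCalls_bind_le_of_forall (A := 1) (B := 50) (maxCalls_ask _) fun v => ?_
    split_ifs
    · exact maxCalls_bind_le_of_forall (A := 50) (B := 0) (maxCalls_confirmDirection i _ 25)
        fun _ => (maxCalls_pure _).le
    · exact Nat.zero_le _
  · exact Nat.zero_le _

theorem maxCalls_pairTest (i : Fin n) (S : List (Cube n)) :
    maxCalls f (pairTest i S) ≤ S.length := by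
  rw [← List.length_map fun z => flipBit z i]
  refine maxCalls_bind_le_of_forall (B := 0) (maxCalls_askAll _) fun vs => ?_
  split_ifs <;> exact (maxCalls_pure _).le

theorem maxCalls_unbiasedStep (d : PString n) (h : (unfixedCoords d).Nonempty) (r : ℕ) :
    maxCalls f (unbiasedStep d h r) ≤ 6 * 2 ^ r := by
  rw [unbiasedStep_eq, show 6 * 2 ^ r = 0 + (3 * 2 ^ r + 3 * 2 ^ r) by omega]
  refine maxCalls_bind_le_of_forall (maxCalls_uniformFrom h).le fun i => ?_
  exact maxCalls_bind_le (maxCalls_samples _) ((always_samples _).mono fun S hS =>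
    hS.1 ▸ maxCalls_pairTest i S)

theorem maxCalls_runAll_replicate {p : OracleProg n Bool} {c : ℕ} (h : maxCalls f p ≤ c) (k : ℕ) :
    maxCalls f (runAll (List.replicate k p)) ≤ k * c := by
  refine maxCalls_runAll.trans ?_
  rw [List.map_replicate, List.sum_replicate, smul_eq_mul]
  exact Nat.mul_le_mul_left k h

theorem maxCalls_biasedTest {M M' ε' : ℝ} (hε : 0 < ε') (hM : M ≤ M') (d : PString n) :
    maxCalls f (biasedTest M ε' d) ≤ 10 * ⌈M' / ε'⌉₊ * 52 := by
  rw [biasedTest]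
  split_ifs
  · exact Nat.zero_le _
  · refine (maxCalls_runAll_replicate (maxCalls_biasedStep d) _).trans ?_
    gcongr

theorem maxCalls_unbiasedTest {U ε' : ℝ} (hε : 0 < ε') {d : PString n}
    (hU : ((unfixedCoords d).card : ℝ) ≤ U) :
    maxCalls f (unbiasedTest ε' d) ≤ ∑ j ∈ range (⌈Real.logb 2 (U / ε')⌉₊ + 2),
      ⌈50 * U / (ε' * 2 ^ (j + 1))⌉₊ * (6 * 2 ^ (j + 1)) := by
  rw [unbiasedTest]
  split_ifs with h
  · have h0 : (0 : ℝ) < (unfixedCoords d).card := by exact_mod_cast h.card_pos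
    refine maxCalls_runAll.trans ?_
    rw [List.map_map, sum_map_range]
    refine (sum_le_sum fun j _ => ?_).trans
      (sum_le_sum_of_subset (range_mono (Nat.add_le_add_right (Nat.ceil_le_ceil ?_) 2)))
    · refine (maxCalls_runAll_replicate (maxCalls_unbiasedStep d h (j + 1)) _).trans ?_
      gcongr
    · exact Real.logb_le_logb_of_le (by norm_num) (by positivity) (by gcongr)
  · exact Nat.zero_le _

theorem maxCalls_unatenessTesterKnownN {N : ℕ} (hN : 2 ≤ N) {ε : ℝ} (hε : 0 < ε) :
    maxCalls f (unatenessTesterKnownN n N ε) ≤ totalCalls (Real.logb 2 N) ε := by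
  have hl := one_le_logb hN
  rw [unatenessTesterKnownN, totalCalls]
  refine maxCalls_bind_le_of_forall maxCalls_sample fun a => ?_
  refine maxCalls_bind_le (maxCalls_samples _) ((always_samples _).mono fun S hS => ?_)
  split_ifs with hfar
  · exact Nat.zero_le _
  have hS0 : 0 < S.length := by
    rw [hS.1]; exact Nat.ceil_pos.2 (by linarith)
  push Not at hfar
  have h1 := card_diffSet_biasVector_le hS0 hfar
  have h2 := card_unfixedCoords_biasVector_le hS0 hfar
  refine maxCalls_bind_le_of_forall (maxCalls_samples _) fun T => ?_
  split_ifs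
  · exact Nat.zero_le _
  refine maxCalls_runAll.trans ?_
  rw [sum_snd_stepCosts]
  simp only [List.map_cons, List.map_nil, List.sum_cons, List.sum_nil, add_zero]
  exact Nat.add_le_add (maxCalls_biasedTest (by positivity) (by linarith) _)
    (maxCalls_unbiasedTest (by positivity) (by linarith))

end RelUnate

open RelUnate in
theorem mainTheorem1 :
    (MakesSoftOCalls unatenessTesterKnownN 2 ∧
      AlwaysAcceptsUnate unatenessTesterKnownN ∧
      RejectsFarFromUnate unatenessTesterKnownN) ∧
    (∃ A : Tester,
      (∀ (n N : ℕ) (ε : ℝ), ∃ m : ℕ, OracleProg.NonAdaptive m (A n N ε)) ∧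
      MakesSoftOCalls A 1 ∧
      AlwaysAcceptsUnate A ∧
      RejectsFarFromUnate A) := by
  refine ⟨⟨⟨3000000, 1, fun n f ε _ hN hε hε1 => ?_⟩, fun n f hf ε _ _ hu => ?_,
    fun n f hf ε hε _ hfar => ?_⟩, ?_⟩
  · exact (Nat.cast_le.2 (maxCalls_unatenessTesterKnownN hN hε)).trans
      (totalCalls_le (one_le_logb hN) hε hε1)
  · exact OracleProg.run_true_of_always hf (always_unatenessTesterKnownN hu ε)
  · exact OracleProg.le_run_false hf (acc_unatenessTesterKnownN_le hf hε hfar)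
  choose m A hA1 hA2 hA3 using hasNonAdaptive_parTester
  refine ⟨A, fun n N ε => ⟨m n N ε, hA1 n N ε⟩, ⟨3000000, 1, fun n f ε hf hN hε hε1 => ?_⟩,
    fun n f hf ε _ _ hu => ?_, fun n f hf ε hε _ hfar => ?_⟩
  · refine (Nat.cast_le.2 (hA3 n _ ε f)).trans ?_
    split_ifs with h
    · rw [le_antisymm h hN]; simp
    · exact totalCalls_le (one_le_logb (by omega)) hε hε1
  · rw [hA2]
    exact OracleProg.run_true_of_always hf (always_parTester hu ε)
  · rw [hA2]
    exact OracleProg.le_run_false hf (acc_parTester_le hf hε hfar)
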